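/- Let $\mathcal V$ be a semi-abelian variety of algebras, that is, a (finitary, one-sorted) variety of universal algebras which, as a category, is semi-abelian: pointed, Barr exact, Bourn protomodular, with binary coproducts. An object $P$ of a category is called projective if it has the lifting property with respect to regular epimorphisms: for every regular epimorphism $e\colon X\to Y$ and every $f\colon P\to Y$ there is $g\colon P\to X$ with $eg=f$. A category with zero morphisms satisfies Condition (P) if, for every split short exact sequence $0\to K\xrightarrow{k} X\rightleftarrows Y\to 0$ (a split epimorphism $f\colon X\to Y$ with section $s$ and kernel $k$), if $X$ is projective then $K$ is projective. For objects $A,B,C$ of $\mathcal V$ let $h_{A,B}\colon A\diamond B\to A+B$ be the kernel of the canonical morphism $A+B\to A\times B$, and let $h_{A,B,C}\colon A\diamond B\diamond C\to A+B+C$ be the kernel of the canonical morphism $A+B+C\to (A+B)\times(A+C)\times(B+C)$; both constructions are functorial. Let $S_{2,1}\colon A\diamond A\diamond B\to A\diamond B$ and $S_{1,2}\colon A\diamond B\diamond B\to A\diamond B$ be induced by the folding morphisms $A+A+B\to A+B$ and $A+B+B\to A+B$, and let $c_A\colon A\diamond A\to A$ be the composite of $h_{A,A}$ with the folding morphism $A+A\to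 A$. An internal crossed module $(X,A,\psi,\partial)$ in $\mathcal V$ consists of objects $X,A$ and morphisms $\partial\colon X\to A$ and $\psi\colon A\diamond X\to X$ such that - $\psi$ is an action core: there is a split short exact sequence with kernel $k\colon X\to E$, split epimorphism $p\colon E\to A$ and section $s\colon A\to E$ such that $k\psi=[s,k]\,h_{A,X}$; - $c_A(1_A\diamond\partial)=\partial\psi$; - $\psi(\partial\diamond 1_X)=c_X$; - $\psi S_{1,2}=\psi S_{2,1}(1_A\diamond\partial\diamond 1_X)$. A morphism $(X,A,\psi,\partial)\to(X',A',\psi',\partial')$ is a pair $f_X\colon X\to X'$, $f_A\colon A\to A'$ with $f_A\partial=\partial' f_X$ and $f_X\psi=\psi'(f_A\diamond f_X)$. These form the category $\mathrm{XMod}(\mathcal V)$ of internal crossed modules in $\mathcal V$. **Theorem.** A semi-abelian variety $\mathcal V$ satisfies Condition (P) if and only if $\mathrm{XMod}(\mathcal V)$ satisfies Condition (P). -/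

import Mathlib

open CategoryTheory CategoryTheory.Limits

universe u v w

namespace SemiAb

/-! ### Varieties of universal algebras -/

section Varieties

variable (L : FirstOrder.Language.{u, w}) (E : Set (L.Term ℕ × L.Term ℕ))

/-- An algebra of the variety of (finitary, one-sorted) algebras whose operation symbols are the
function symbols of `L` and whose identities are the pairs of terms in `E`. It is used for languages
`L` without relation symbols. -/
structure Alg where
  /-- the underlying set -/
  carrier : Type u
  /-- the operations -/
  [str : L.Structure carrier]
  /-- the identities hold -/
  sat : ∀ e ∈ E, ∀ x : ℕ → carrier, e.1.realize x = e.2.realize x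

attribute [instance] Alg.str

/-- The variety as a category: morphisms are the homomorphisms of algebras. -/
instance : Category (Alg L E) where
  Hom A B := L.Hom A.carrier B.carrier
  id A := FirstOrder.Language.Hom.id L A.carrier
  comp f g := g.comp f

end Varieties

/-! ### Split extensions, semi-abelian categories, Condition (P) -/

section Basic

variable {C : Type u} [Category.{v} C] [HasZeroMorphisms C]

/-- `k : X ⟶ E`, `p : E ⟶ A`, `s : A ⟶ E` form a split extension (split short exact sequence):
`s` is a section of `p` and `k` is a kernel of `p`. -/
structure IsSplitExtension {X E A : C} (k : X ⟶ E) (p : E ⟶ A) (s : A ⟶ E) : Prop where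
  section_comp : s ≫ p = 𝟙 A
  comp_zero : k ≫ p = 0
  isKernel : Nonempty (IsLimit (KernelFork.ofι k comp_zero))

variable (C) in
/-- A semi-abelian category: pointed, Barr exact (regular, and every internal equivalence
relation is effective), with binary coproducts, and Bourn protomodular (in the form of the split
short five lemma). -/
class IsSemiAbelian : Prop extends Regular C where
  hasZeroObject : HasZeroObject C
  hasBinaryCoproducts : HasBinaryCoproducts C
  effective : ∀ {R X : C} (p₁ p₂ : R ⟶ X), IsEquivalenceRelation p₁ p₂ →
    IsEffectiveEquivalenceRelation p₁ p₂
  splitShortFive : ∀ {X E A X' E' A' : C} {k : X ⟶ E} {p : E ⟶ A} {s : A ⟶ E}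
    {k' : X' ⟶ E'} {p' : E' ⟶ A'} {s' : A' ⟶ E'} (a : X ⟶ X') (b : E ⟶ E') (c : A ⟶ A'),
    IsSplitExtension k p s → IsSplitExtension k' p' s' →
    k ≫ b = a ≫ k' → p ≫ c = b ≫ p' → s ≫ b = c ≫ s' →
    IsIso a → IsIso c → IsIso b

attribute [instance] IsSemiAbelian.hasZeroObject IsSemiAbelian.hasBinaryCoproducts

/-- Projectivity with respect to regular epimorphisms. (Mathlib's `Projective` refers to all
epimorphisms; these need not be regular in a semi-abelian category.) -/
def IsRegProjective {D : Type u} [Category.{v} D] (P : D) : Prop :=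
  ∀ ⦃X Y : D⦄ (e : X ⟶ Y) (f : P ⟶ Y), IsRegularEpi e → ∃ g : P ⟶ X, g ≫ e = f

variable (C) in
/-- Condition (P): for every split short exact sequence, if the middle object is projective, then
so is the kernel. -/
def ConditionP : Prop :=
  ∀ ⦃K X Y : C⦄ (k : K ⟶ X) (f : X ⟶ Y) (s : Y ⟶ X),
    IsSplitExtension k f s → IsRegProjective X → IsRegProjective K

end Basic

/-! ### Cosmash products -/

noncomputable section

set_option linter.unusedSimpArgs false

variable {C : Type u} [Category.{v} C] [HasZeroMorphisms C] [IsSemiAbelian C]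

/-- The comparison morphism `A + B ⟶ A × B`. -/
def sigma₂ (A B : C) : A ⨿ B ⟶ A ⨯ B :=
  prod.lift (coprod.desc (𝟙 A) 0) (coprod.desc 0 (𝟙 B))

/-- The cosmash product of `A` and `B`. -/
def cosmash (A B : C) : C := kernel (sigma₂ A B)

/-- The inclusion of the cosmash product into the coproduct. -/
def cosmashι (A B : C) : cosmash A B ⟶ A ⨿ B := kernel.ι (sigma₂ A B)

instance (A B : C) : Mono (cosmashι A B) := inferInstanceAs (Mono (kernel.ι (sigma₂ A B)))

/-- Functoriality of the cosmash product. -/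
def cosmashMap {A A' B B' : C} (f : A ⟶ A') (g : B ⟶ B') : cosmash A B ⟶ cosmash A' B' :=
  kernel.map (sigma₂ A B) (sigma₂ A' B') (coprod.map f g) (prod.map f g) (by
    ext <;> simp [sigma₂, prod.lift_fst, prod.lift_snd, prod.lift_fst_assoc,
        prod.lift_snd_assoc, coprod.inl_desc, coprod.inr_desc, coprod.inl_desc_assoc, coprod.inr_desc_assoc])

lemma cosmashMap_ι {A A' B B' : C} (f : A ⟶ A') (g : B ⟶ B') :
    cosmashMap f g ≫ cosmashι A' B' = cosmashι A B ≫ coprod.map f g := by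
  exact kernel.lift_ι _ _ _

lemma cosmashMap_id (A B : C) : cosmashMap (𝟙 A) (𝟙 B) = 𝟙 (cosmash A B) := by
  simp [← cancel_mono (cosmashι A B), cosmashMap_ι]

lemma cosmashMap_comp {A A' A'' B B' B'' : C} (f : A ⟶ A') (f' : A' ⟶ A'') (g : B ⟶ B')
    (g' : B' ⟶ B'') : cosmashMap (f ≫ f') (g ≫ g') = cosmashMap f g ≫ cosmashMap f' g' := by
  simp [← cancel_mono (cosmashι A'' B''), cosmashMap_ι, reassoc_of% cosmashMap_ι]

lemma cosmashMap_zero (A A' B B' : C) :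
    cosmashMap (0 : A ⟶ A') (0 : B ⟶ B') = 0 := by
  rw [← cancel_mono (cosmashι A' B'), cosmashMap_ι, zero_comp]
  have : coprod.map (0 : A ⟶ A') (0 : B ⟶ B') = 0 := by ext <;> simp
  rw [this, comp_zero]

/-- The comparison morphism `A + B + C ⟶ (A + B) × (A + C) × (B + C)`. -/
def sigma₃ (A B D : C) : (A ⨿ B) ⨿ D ⟶ (A ⨿ B) ⨯ ((A ⨿ D) ⨯ (B ⨿ D)) :=
  prod.lift (coprod.desc (coprod.desc coprod.inl coprod.inr) 0)
    (prod.lift (coprod.desc (coprod.desc coprod.inl 0) coprod.inr)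
      (coprod.desc (coprod.desc 0 coprod.inl) coprod.inr))

/-- The ternary cosmash product of `A`, `B` and `D`. -/
def cosmash₃ (A B D : C) : C := kernel (sigma₃ A B D)

/-- The inclusion of the ternary cosmash product into the coproduct. -/
def cosmash₃ι (A B D : C) : cosmash₃ A B D ⟶ (A ⨿ B) ⨿ D := kernel.ι (sigma₃ A B D)

instance (A B D : C) : Mono (cosmash₃ι A B D) := inferInstanceAs (Mono (kernel.ι (sigma₃ A B D)))

/-- Functoriality of the ternary cosmash product. -/
def cosmash₃Map {A A' B B' D D' : C} (f : A ⟶ A') (g : B ⟶ B') (h : D ⟶ D') :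
    cosmash₃ A B D ⟶ cosmash₃ A' B' D' :=
  kernel.map (sigma₃ A B D) (sigma₃ A' B' D') (coprod.map (coprod.map f g) h)
    (prod.map (coprod.map f g) (prod.map (coprod.map f h) (coprod.map g h))) (by
      ext <;> simp [sigma₃, prod.lift_fst, prod.lift_snd, prod.lift_fst_assoc,
        prod.lift_snd_assoc, coprod.inl_desc, coprod.inr_desc, coprod.inl_desc_assoc, coprod.inr_desc_assoc])

/-- The left folding morphism `S₂₁`, induced by `[1, 1] + 1 : A + A + B ⟶ A + B`. -/
def fold₂₁ (A B : C) : cosmash₃ A A B ⟶ cosmash A B :=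
  kernel.map (sigma₃ A A B) (sigma₂ A B) (coprod.map (coprod.desc (𝟙 A) (𝟙 A)) (𝟙 B))
    (prod.map (coprod.desc (𝟙 A) (𝟙 A)) (prod.snd ≫ coprod.desc 0 (𝟙 B))) (by
      ext <;> simp [sigma₃, sigma₂, prod.lift_fst, prod.lift_snd, prod.lift_fst_assoc,
        prod.lift_snd_assoc, coprod.inl_desc, coprod.inr_desc, coprod.inl_desc_assoc, coprod.inr_desc_assoc])

/-- The right folding morphism `S₁₂`, induced by `1 + [1, 1] : A + B + B ⟶ A + B`. -/
def fold₁₂ (A B : C) : cosmash₃ A B B ⟶ cosmash A B :=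
  kernel.map (sigma₃ A B B) (sigma₂ A B) (coprod.desc (𝟙 (A ⨿ B)) coprod.inr)
    (prod.lift (prod.snd ≫ prod.fst ≫ coprod.desc (𝟙 A) 0)
      (prod.snd ≫ prod.snd ≫ coprod.desc (𝟙 B) (𝟙 B))) (by
      ext <;> simp [sigma₃, sigma₂, prod.lift_fst, prod.lift_snd, prod.lift_fst_assoc,
        prod.lift_snd_assoc, coprod.inl_desc, coprod.inr_desc, coprod.inl_desc_assoc, coprod.inr_desc_assoc])

/-- The conjugation action core of an object on itself. -/
def conj (A : C) : cosmash A A ⟶ A := cosmashι A A ≫ coprod.desc (𝟙 A) (𝟙 A)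

/-- `ψ : A ⋄ X ⟶ X` is an action core: it is associated to some split extension
`X ⟶ E ⇄ A`, that is, it is the restriction to `A ⋄ X` of `[s, k] : A + X ⟶ E`. -/
def IsActionCore {A X : C} (ψ : cosmash A X ⟶ X) : Prop :=
  ∃ (E : C) (k : X ⟶ E) (p : E ⟶ A) (s : A ⟶ E),
    IsSplitExtension k p s ∧ ψ ≫ k = cosmashι A X ≫ coprod.desc s k

/-! ### Internal crossed modules -/

variable (C) in
/-- An internal crossed module `(X, A, ψ, ∂)`. -/
structure XMod where
  X : C
  A : C
  /-- the action core -/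
  act : cosmash A X ⟶ X
  /-- the boundary morphism -/
  bd : X ⟶ A
  isActionCore : IsActionCore act
  precrossed : cosmashMap (𝟙 A) bd ≫ conj A = act ≫ bd
  peiffer : cosmashMap bd (𝟙 X) ≫ act = conj X
  ternary : fold₁₂ A X ≫ act = cosmash₃Map (𝟙 A) bd (𝟙 X) ≫ fold₂₁ A X ≫ act

namespace XMod

/-- A morphism of internal crossed modules: a pair of morphisms commuting with the boundaries and
equivariant with respect to the action cores. -/
@[ext]
structure Hom (M N : XMod C) where
  fX : M.X ⟶ N.X
  fA : M.A ⟶ N.A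
  bd_comm : M.bd ≫ fA = fX ≫ N.bd
  equivariant : M.act ≫ fX = cosmashMap fA fX ≫ N.act

/-- The category of internal crossed modules. -/
instance : Category (XMod C) where
  Hom := Hom
  id M := ⟨𝟙 _, 𝟙 _, by simp, by simp [cosmashMap_id]⟩
  comp {M N O} f g := ⟨f.fX ≫ g.fX, f.fA ≫ g.fA, by
      rw [reassoc_of% f.bd_comm, g.bd_comm, Category.assoc], by
      rw [reassoc_of% f.equivariant, g.equivariant, cosmashMap_comp, Category.assoc]⟩
  id_comp f := Hom.ext (Category.id_comp _) (Category.id_comp _)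
  comp_id f := Hom.ext (Category.comp_id _) (Category.comp_id _)
  assoc f g h := Hom.ext (Category.assoc _ _ _) (Category.assoc _ _ _)

/-- The zero morphisms of crossed modules are the pairs of zero morphisms. -/
instance : HasZeroMorphisms (XMod C) where
  zero M N := ⟨⟨0, 0, by simp, by simp [cosmashMap_zero]⟩⟩
  comp_zero f O := Hom.ext comp_zero comp_zero
  zero_comp M N O f := Hom.ext zero_comp zero_comp

end XMod

end

end SemiAb

/-! Projective crossed modules are retracts of free ones. The free crossed module on a pair `(Q, X)`
is the kernel inclusion `Q ♭ X ⟶ Q + X` of `[1, 0] : Q + X ⟶ Q` (`exists_free_hom`, `free_hom_ext`).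
Regular epimorphisms of crossed modules are the morphisms whose two components are strong
epimorphisms (`strongEpi_fA`, `strongEpi_fX`, `isRegularEpi_of_components`). So `free Q X` is
projective when `Q` and `X` are and, given enough projectives in the base, every crossed module is a
regular quotient of such an object. Splitting an idempotent shows that the boundary of a projective
crossed module is the kernel of a split epimorphism `A ⟶ Q` with `A` and `Q` projective; conversely,
such a kernel with projective domain is a projective crossed module.

Let `K ⟶ M ⇄ N` be a split extension of crossed modules with `M` projective. Then `N` is a retract
of `M`, so both boundaries are kernels of split epimorphisms, onto `QM` and `QN`. Kernels of crossed
modules are computed componentwise, so Condition (P) in the base makes `K.A`, `K.X` and the kernel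
of `QM ⟶ QN` projective. By `strongEpi_kernel`, `K.A` maps onto that last kernel by a strong
epimorphism, which therefore splits; its kernel is `K.bd`, so `K` is projective.

In the other direction, `A ↦ (0 ⟶ A)` preserves split extensions, and preserves and reflects
projectivity. Being a variety matters only for the existence of enough projectives, which are the
free algebras. -/

namespace SemiAb

/-! ### Split extensions and protomodularity. -/

section SplitExtensions

variable {C : Type u} [Category.{v} C] [HasZeroMorphisms C]

namespace IsSplitExtension

variable {X E A : C} {k : X ⟶ E} {p : E ⟶ A} {s : A ⟶ E}

lemma exists_lift (h : IsSplitExtension k p s) {T : C} (t : T ⟶ E) (ht : t ≫ p = 0) :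
    ∃ l : T ⟶ X, l ≫ k = t :=
  ⟨_, (KernelFork.IsLimit.lift' h.isKernel.some t ht).2⟩

lemma mono (h : IsSplitExtension k p s) : Mono k :=
  mono_of_isLimit_fork h.isKernel.some

lemma of_lift [Mono k] (hs : s ≫ p = 𝟙 A) (hk : k ≫ p = 0)
    (hl : ∀ {T : C} (t : T ⟶ E), t ≫ p = 0 → ∃ l : T ⟶ X, l ≫ k = t) :
    IsSplitExtension k p s where
  section_comp := hs
  comp_zero := hk
  isKernel := ⟨KernelFork.IsLimit.ofι' k hk fun t ht => ⟨_, (hl t ht).choose_spec⟩⟩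

lemma kernel_ι [HasKernel p] (hs : s ≫ p = 𝟙 A) : IsSplitExtension (kernel.ι p) p s :=
  of_lift hs (kernel.condition p) fun t ht => ⟨kernel.lift p t ht, kernel.lift_ι p t ht⟩

variable [IsSemiAbelian C]

/-- A subobject of the middle object of a split extension which contains the kernel and the
section is everything. -/
lemma isIso_of_mono (h : IsSplitExtension k p s) {S : C} (m : S ⟶ E) [Mono m] (k' : X ⟶ S)
    (s' : A ⟶ S) (hk : k' ≫ m = k) (hs : s' ≫ m = s) : IsIso m := by
  have := h.mono
  have : Mono k' := by
    have : Mono (k' ≫ m) := by rwa [hk]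
    exact mono_of_mono k' m
  have h' : IsSplitExtension k' (m ≫ p) s' := by
    refine of_lift ?_ ?_ ?_
    · rw [reassoc_of% hs, h.section_comp]
    · rw [reassoc_of% hk, h.comp_zero]
    · intro T t ht
      obtain ⟨l, hl⟩ := h.exists_lift (t ≫ m) (by simpa using ht)
      exact ⟨l, by rw [← cancel_mono m, Category.assoc, hk, hl]⟩
  exact IsSemiAbelian.splitShortFive (𝟙 X) m (𝟙 A) h' h (by simp [hk]) (by simp) (by simp [hs])
    inferInstance inferInstance

lemma hom_ext (h : IsSplitExtension k p s) {T : C} {f g : E ⟶ T} (hk : k ≫ f = k ≫ g)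
    (hs : s ≫ f = s ≫ g) : f = g := by
  have := h.isIso_of_mono (equalizer.ι f g) (equalizer.lift k hk) (equalizer.lift s hs)
    (by simp) (by simp)
  rw [← cancel_epi (equalizer.ι f g), equalizer.condition]

/-- A morphism out of the middle object of a split extension factors through a subobject as soon as
its restrictions to the kernel and along the section do. -/
lemma exists_factor (h : IsSplitExtension k p s) {S T : C} (f : E ⟶ T) (m : S ⟶ T) [Mono m]
    (k' : X ⟶ S) (s' : A ⟶ S) (hk : k' ≫ m = k ≫ f) (hs : s' ≫ m = s ≫ f) :
    ∃ g : E ⟶ S, g ≫ m = f := by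
  have := h.isIso_of_mono (pullback.snd m f) (pullback.lift k' k hk) (pullback.lift s' s hs)
    (by simp [pullback.lift_snd]) (by simp [pullback.lift_snd])
  exact ⟨inv (pullback.snd m f) ≫ pullback.fst m f, by
    rw [Category.assoc, pullback.condition, IsIso.inv_hom_id_assoc]⟩

end IsSplitExtension

/-! ### Strong epimorphisms and kernels of split epimorphisms. -/

section StrongEpis

instance strongEpi_of_isRegularEpi {D : Type u} [Category.{v} D] {X Y : D} (f : X ⟶ Y)
    [IsRegularEpi f] : StrongEpi f :=
  inferInstance

variable [IsSemiAbelian C]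

lemma isRegularEpi_of_strongEpi {X Y : C} (f : X ⟶ Y) [StrongEpi f] : IsRegularEpi f :=
  inferInstance

lemma strongEpi_of_forall_mono {X Y : C} (f : X ⟶ Y)
    (h : ∀ ⦃Z : C⦄ (p : X ⟶ Z) (i : Z ⟶ Y), Mono i → p ≫ i = f → IsIso i) : StrongEpi f := by
  have : ExtremalEpi f := .mk_of_hasEqualizers f fun Z p i hi hm => h p i hm hi
  exact (extremalEpi_iff_strongEpi_of_hasPullbacks f).1 this

lemma strongEpi_of_isPullback {P X Y Z : C} {fst : P ⟶ X} {snd : P ⟶ Y} {f : X ⟶ Z} {g : Y ⟶ Z}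
    (h : IsPullback fst snd f g) [StrongEpi g] : StrongEpi fst := by
  have hg := isRegularEpi_of_strongEpi g
  have : IsRegularEpi fst :=
    Regular.regularEpiIsStableUnderBaseChange.of_isPullback h.flip hg
  infer_instance

/-- For a strong epimorphism of split epimorphisms, the induced morphism of kernels is a strong
epimorphism. -/
lemma strongEpi_kernel {X E A X' E' A' : C} {k : X ⟶ E} {p : E ⟶ A} {s : A ⟶ E}
    {k' : X' ⟶ E'} {p' : E' ⟶ A'} {s' : A' ⟶ E'} (h : IsSplitExtension k p s)
    (h' : IsSplitExtension k' p' s') (x : X ⟶ X') (e : E ⟶ E') (a : A ⟶ A') [StrongEpi e]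
    (hx : k ≫ e = x ≫ k') (hp : p ≫ a = e ≫ p') (hs : s ≫ e = a ≫ s') : StrongEpi x := by
  have := h'.mono
  -- It suffices that the comparison `(p, e) : E ⟶ A ×_{A'} E'` is a strong epimorphism: `x` is its
  -- pullback along `(0, k')`.
  have hd : StrongEpi (pullback.lift p e hp) := by
    refine strongEpi_of_forall_mono _ fun S g m hm hgm => ?_
    -- `W` covers `A ×_{A'} E'` and is split over `E` with kernel that of `a`. The section lands in
    -- `S` through `g`, and the kernel of `a` through `s ≫ g`, since `s` followed by `e` vanishes
    -- there. Hence all of `W` lands in `S`.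
    let W := pullback (pullback.snd a p') e
    have hq : StrongEpi (pullback.fst (pullback.snd a p') e) := inferInstance
    have hW : IsSplitExtension
        (pullback.lift (pullback.lift (kernel.ι a) 0 (by simp)) 0 (by simp [pullback.lift_snd]) :
          kernel a ⟶ W)
        (pullback.snd (pullback.snd a p') e)
        (pullback.lift (pullback.lift p e hp) (𝟙 E) (by simp [pullback.lift_snd])) := by
      have : Mono (pullback.lift (pullback.lift (kernel.ι a) 0 (by simp)) 0
          (by simp [pullback.lift_snd]) : kernel a ⟶ W) := by
        refine ⟨fun u v huv => ?_⟩
        have := huv =≫ (pullback.fst (pullback.snd a p') e ≫ pullback.fst a p')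
        simpa [pullback.lift_fst_assoc, pullback.lift_fst, cancel_mono] using this
      refine .of_lift (by simp [pullback.lift_snd]) (by simp [pullback.lift_snd]) ?_
      intro T t ht
      have h1 : t ≫ pullback.fst (pullback.snd a p') e ≫ pullback.snd a p' = 0 := by
        rw [pullback.condition, reassoc_of% ht, zero_comp]
      refine ⟨kernel.lift a (t ≫ pullback.fst (pullback.snd a p') e ≫ pullback.fst a p') ?_, ?_⟩
      · simp only [Category.assoc, pullback.condition]
        rw [reassoc_of% h1, zero_comp]
      · apply pullback.hom_ext
        · apply pullback.hom_ext <;>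
            simp [pullback.lift_fst, pullback.lift_snd, h1]
        · simp [pullback.lift_snd, ht]
    obtain ⟨r, hr⟩ := hW.exists_factor (pullback.fst (pullback.snd a p') e) m
      (kernel.ι a ≫ s ≫ g) g (by
        simp only [Category.assoc, hgm]
        apply pullback.hom_ext
        · simp [pullback.lift_fst, h.section_comp]
        · simp [pullback.lift_fst_assoc, pullback.lift_snd, hs]) (by
        rw [pullback.lift_fst, hgm])
    have : StrongEpi (r ≫ m) := by rwa [hr]
    have : StrongEpi m := strongEpi_of_strongEpi r m
    exact isIso_of_mono_of_strongEpi m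
  have hk' : (0 : X' ⟶ A) ≫ a = k' ≫ p' := by rw [zero_comp, h'.comp_zero]
  have := h.mono
  have hl (c : PullbackCone (pullback.lift 0 k' hk') (pullback.lift p e hp)) :
      ∃ l : c.pt ⟶ X, l ≫ k = c.snd := by
    refine h.exists_lift c.snd ?_
    have := c.condition =≫ pullback.fst a p'
    simpa [pullback.lift_fst] using this.symm
  choose l hl using hl
  refine strongEpi_of_isPullback (f := pullback.lift 0 k' hk') (snd := k)
    (g := pullback.lift p e hp) ⟨⟨?_⟩, ⟨PullbackCone.IsLimit.mk _ l (fun c => ?_) hl ?_⟩⟩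
  · apply pullback.hom_ext
    · simp [pullback.lift_fst, h.comp_zero]
    · simp [pullback.lift_snd, hx]
  · rw [← cancel_mono k', Category.assoc, ← hx, reassoc_of% hl]
    have := c.condition =≫ pullback.snd a p'
    simpa [pullback.lift_snd] using this.symm
  · intro c m _ hm
    rw [← cancel_mono k, hm, hl]

end StrongEpis

end SplitExtensions

end SemiAb

namespace SemiAb

/-! ### Cosmash products, and semi-direct products determined by action cores. -/

section Cosmash

variable {C : Type u} [Category.{v} C] [HasZeroMorphisms C] [IsSemiAbelian C]

attribute [local simp] coprod.inl_desc coprod.inr_desc coprod.inl_desc_assoc coprod.inr_desc_assoc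
  prod.lift_fst prod.lift_snd prod.lift_fst_assoc prod.lift_snd_assoc

lemma strongEpi_coprod_map {A A' B B' : C} (f : A ⟶ A') (g : B ⟶ B') [StrongEpi f] [StrongEpi g] :
    StrongEpi (coprod.map f g) := by
  refine strongEpi_of_forall_mono _ fun Z p i hi hp => ?_
  have hf : CommSq (coprod.inl ≫ p) f i coprod.inl := ⟨by simp [hp]⟩
  have hg : CommSq (coprod.inr ≫ p) g i coprod.inr := ⟨by simp [hp]⟩
  have : IsSplitEpi i := ⟨⟨⟨coprod.desc hf.lift hg.lift, by ext <;> simp⟩⟩⟩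
  exact isIso_of_mono_of_isSplitEpi i

lemma cosmashι_desc_one_zero (A B : C) : cosmashι A B ≫ coprod.desc (𝟙 A) 0 = 0 := by
  have : cosmashι A B ≫ sigma₂ A B = 0 := kernel.condition (sigma₂ A B)
  simpa [sigma₂, -zero_comp] using this =≫ prod.fst |>.trans zero_comp

lemma cosmashι_desc_zero_one (A B : C) : cosmashι A B ≫ coprod.desc 0 (𝟙 B) = 0 := by
  have : cosmashι A B ≫ sigma₂ A B = 0 := kernel.condition (sigma₂ A B)
  simpa [sigma₂, -zero_comp] using this =≫ prod.snd |>.trans zero_comp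

lemma cosmash_exists_lift {A B T : C} (t : T ⟶ A ⨿ B) (h₁ : t ≫ coprod.desc (𝟙 A) 0 = 0)
    (h₂ : t ≫ coprod.desc 0 (𝟙 B) = 0) : ∃ l : T ⟶ cosmash A B, l ≫ cosmashι A B = t :=
  ⟨kernel.lift _ t (by apply prod.hom_ext <;> simp [sigma₂, h₁, h₂]), kernel.lift_ι _ _ _⟩

lemma cosmashι_desc_left_zero {A B T : C} (f : A ⟶ T) :
    cosmashι A B ≫ coprod.desc f 0 = 0 := by
  have : coprod.desc f (0 : B ⟶ T) = coprod.desc (𝟙 A) 0 ≫ f := by ext <;> simp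
  rw [this, reassoc_of% cosmashι_desc_one_zero, zero_comp]

lemma cosmashι_desc_right_zero {A B T : C} (f : B ⟶ T) :
    cosmashι A B ≫ coprod.desc 0 f = 0 := by
  have : coprod.desc (0 : A ⟶ T) f = coprod.desc 0 (𝟙 B) ≫ f := by ext <;> simp
  rw [this, reassoc_of% cosmashι_desc_zero_one, zero_comp]

lemma cosmashMap_ι_desc {A A' B B' T : C} (f : A ⟶ A') (g : B ⟶ B') (a : A' ⟶ T) (b : B' ⟶ T) :
    cosmashMap f g ≫ cosmashι A' B' ≫ coprod.desc a b =
      cosmashι A B ≫ coprod.desc (f ≫ a) (g ≫ b) := by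
  rw [reassoc_of% cosmashMap_ι]
  congr 1
  ext <;> simp

lemma cosmashMap_zero_left {A A' B B' : C} (g : B ⟶ B') :
    cosmashMap (0 : A ⟶ A') g = 0 := by
  have : coprod.map (0 : A ⟶ A') g = coprod.desc 0 (g ≫ coprod.inr) := by ext <;> simp
  rw [← cancel_mono (cosmashι A' B'), cosmashMap_ι, zero_comp, this, cosmashι_desc_right_zero]

lemma cosmashMap_zero_right {A A' B B' : C} (f : A ⟶ A') :
    cosmashMap f (0 : B ⟶ B') = 0 := by
  have : coprod.map f (0 : B ⟶ B') = coprod.desc (f ≫ coprod.inl) 0 := by ext <;> simp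
  rw [← cancel_mono (cosmashι A' B'), cosmashMap_ι, zero_comp, this, cosmashι_desc_left_zero]

/-- The inclusion of `A ⋄ B` into the kernel `A ♭ B` of `[1, 0] : A + B ⟶ A`. -/
noncomputable def cosmashToFlat (A B : C) :
    cosmash A B ⟶ kernel (coprod.desc (𝟙 A) (0 : B ⟶ A)) :=
  kernel.lift _ (cosmashι A B) (cosmashι_desc_one_zero A B)

lemma cosmashToFlat_ι (A B : C) : cosmashToFlat A B ≫ kernel.ι _ = cosmashι A B :=
  kernel.lift_ι _ _ _

/-- The inclusion of `B` into the kernel `A ♭ B` of `[1, 0] : A + B ⟶ A`. -/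
noncomputable def inrFlat (A B : C) : B ⟶ kernel (coprod.desc (𝟙 A) (0 : B ⟶ A)) :=
  kernel.lift _ coprod.inr (by simp)

lemma inrFlat_ι (A B : C) : inrFlat A B ≫ kernel.ι _ = coprod.inr :=
  kernel.lift_ι _ _ _

lemma isSplitExtension_coprod (A B : C) :
    IsSplitExtension (kernel.ι (coprod.desc (𝟙 A) (0 : B ⟶ A))) (coprod.desc (𝟙 A) (0 : B ⟶ A))
      coprod.inl :=
  .kernel_ι (by simp)

lemma isSplitExtension_cosmashToFlat (A B : C) :
    IsSplitExtension (cosmashToFlat A B) (kernel.ι _ ≫ coprod.desc 0 (𝟙 B)) (inrFlat A B) := by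
  have : Mono (cosmashToFlat A B ≫ kernel.ι _) := by rw [cosmashToFlat_ι]; infer_instance
  have : Mono (cosmashToFlat A B) := mono_of_mono _ (kernel.ι _)
  refine .of_lift ?_ ?_ fun t ht => ?_
  · rw [reassoc_of% inrFlat_ι]; simp
  · rw [reassoc_of% cosmashToFlat_ι, cosmashι_desc_zero_one]
  · obtain ⟨l, hl⟩ := cosmash_exists_lift (t ≫ kernel.ι _) (by simp) (by simpa using ht)
    exact ⟨l, by rw [← cancel_mono (kernel.ι _), Category.assoc, cosmashToFlat_ι, hl]⟩

/-- `A ♭ B` is the kernel of the split epimorphism `A + B ⟶ A`, and `A ⋄ B` that of `A ♭ B ⟶ B`, so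
`strongEpi_kernel` applies twice. -/
instance strongEpi_cosmashMap {A A' B B' : C} (f : A ⟶ A') (g : B ⟶ B') [StrongEpi f]
    [StrongEpi g] : StrongEpi (cosmashMap f g) := by
  have := strongEpi_coprod_map f g
  let e : kernel (coprod.desc (𝟙 A) (0 : B ⟶ A)) ⟶ kernel (coprod.desc (𝟙 A') (0 : B' ⟶ A')) :=
    kernel.map _ _ (coprod.map f g) f (by ext <;> simp)
  have he : e ≫ kernel.ι _ = kernel.ι _ ≫ coprod.map f g := kernel.lift_ι _ _ _
  have : StrongEpi e := strongEpi_kernel (isSplitExtension_coprod A B)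
    (isSplitExtension_coprod A' B') e (coprod.map f g) f he.symm (by ext <;> simp) (by simp)
  refine strongEpi_kernel (isSplitExtension_cosmashToFlat A B)
    (isSplitExtension_cosmashToFlat A' B') _ e g ?_ ?_ ?_
  · rw [← cancel_mono (kernel.ι _), Category.assoc, he, reassoc_of% cosmashToFlat_ι, Category.assoc,
      cosmashToFlat_ι, cosmashMap_ι]
  · rw [reassoc_of% he, Category.assoc]
    congr 1
    ext <;> simp
  · rw [← cancel_mono (kernel.ι _), Category.assoc, he, reassoc_of% inrFlat_ι, Category.assoc,
      inrFlat_ι]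
    simp

lemma cosmash₃ι_left (A B D : C) :
    cosmash₃ι A B D ≫ coprod.desc (𝟙 (A ⨿ B)) 0 = 0 := by
  have := kernel.condition (sigma₃ A B D) =≫ prod.fst
  rw [zero_comp, Category.assoc] at this
  refine Eq.trans ?_ this
  change cosmash₃ι A B D ≫ _ = cosmash₃ι A B D ≫ _
  congr 1
  ext <;> simp [sigma₃]

lemma cosmash₃ι_middle (A B D : C) :
    cosmash₃ι A B D ≫ coprod.map (coprod.desc (𝟙 A) (0 : B ⟶ A)) (𝟙 D) = 0 := by
  have := kernel.condition (sigma₃ A B D) =≫ (prod.snd ≫ prod.fst)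
  rw [zero_comp, Category.assoc] at this
  refine Eq.trans ?_ this
  change cosmash₃ι A B D ≫ _ = cosmash₃ι A B D ≫ _
  congr 1
  ext <;> simp [sigma₃]

lemma cosmash₃ι_right (A B D : C) :
    cosmash₃ι A B D ≫ coprod.map (coprod.desc (0 : A ⟶ B) (𝟙 B)) (𝟙 D) = 0 := by
  have := kernel.condition (sigma₃ A B D) =≫ (prod.snd ≫ prod.snd)
  rw [zero_comp, Category.assoc] at this
  refine Eq.trans ?_ this
  change cosmash₃ι A B D ≫ _ = cosmash₃ι A B D ≫ _
  congr 1
  ext <;> simp [sigma₃]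

lemma cosmash₃_exists_lift {A B D T : C} (t : T ⟶ (A ⨿ B) ⨿ D)
    (h₁ : t ≫ coprod.desc (𝟙 (A ⨿ B)) 0 = 0)
    (h₂ : t ≫ coprod.map (coprod.desc (𝟙 A) (0 : B ⟶ A)) (𝟙 D) = 0)
    (h₃ : t ≫ coprod.map (coprod.desc (0 : A ⟶ B) (𝟙 B)) (𝟙 D) = 0) :
    ∃ l : T ⟶ cosmash₃ A B D, l ≫ cosmash₃ι A B D = t := by
  refine ⟨kernel.lift _ t ?_, kernel.lift_ι _ _ _⟩
  rw [show sigma₃ A B D = prod.lift (coprod.desc (𝟙 (A ⨿ B)) 0)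
    (prod.lift (coprod.map (coprod.desc (𝟙 A) (0 : B ⟶ A)) (𝟙 D))
      (coprod.map (coprod.desc (0 : A ⟶ B) (𝟙 B)) (𝟙 D))) by
    apply prod.hom_ext
    · ext <;> simp [sigma₃]
    · apply prod.hom_ext <;> ext <;> simp [sigma₃]]
  apply prod.hom_ext
  · simp [h₁]
  · apply prod.hom_ext <;> simp [h₂, h₃]

/-- The canonical morphism `A ⋄ B ⋄ D ⟶ (A + B) ⋄ D`. -/
noncomputable def cosmash₃ToCosmash (A B D : C) : cosmash₃ A B D ⟶ cosmash (A ⨿ B) D :=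
  kernel.lift _ (cosmash₃ι A B D) (by
    apply prod.hom_ext
    · simp [sigma₂, cosmash₃ι_left]
    · have := (cosmash₃ι_right A B D) =≫ coprod.desc 0 (𝟙 D)
      rw [zero_comp, Category.assoc] at this
      rw [zero_comp, Category.assoc]
      refine Eq.trans ?_ this
      congr 1
      ext <;> simp [sigma₂])

lemma cosmash₃ToCosmash_ι (A B D : C) :
    cosmash₃ToCosmash A B D ≫ cosmashι (A ⨿ B) D = cosmash₃ι A B D :=
  kernel.lift_ι _ _ _

/-- `(A + B) ⋄ D` is generated by `A ⋄ D`, `B ⋄ D` and `A ⋄ B ⋄ D`. -/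
lemma cosmash_coprod_hom_ext {A B D T : C} {f g : cosmash (A ⨿ B) D ⟶ T}
    (h₁ : cosmashMap coprod.inl (𝟙 D) ≫ f = cosmashMap coprod.inl (𝟙 D) ≫ g)
    (h₂ : cosmashMap coprod.inr (𝟙 D) ≫ f = cosmashMap coprod.inr (𝟙 D) ≫ g)
    (h₃ : cosmash₃ToCosmash A B D ≫ f = cosmash₃ToCosmash A B D ≫ g) : f = g := by
  -- Two nested split extensions: `ρ` is split over `A ⋄ D`, and its kernel is split over `B ⋄ D`
  -- with kernel `A ⋄ B ⋄ D`.
  let ρ : cosmash (A ⨿ B) D ⟶ cosmash A D := cosmashMap (coprod.desc (𝟙 A) 0) (𝟙 D)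
  let τ : cosmash (A ⨿ B) D ⟶ cosmash B D := cosmashMap (coprod.desc 0 (𝟙 B)) (𝟙 D)
  have hρ : IsSplitExtension (kernel.ι ρ) ρ (cosmashMap coprod.inl (𝟙 D)) := .kernel_ι (by
    rw [← cosmashMap_comp]; simp [cosmashMap_id])
  let i : cosmash B D ⟶ kernel ρ := kernel.lift ρ (cosmashMap coprod.inr (𝟙 D)) (by
    rw [← cosmashMap_comp]; simp [cosmashMap_zero_left])
  have hi : i ≫ kernel.ι ρ = cosmashMap coprod.inr (𝟙 D) := kernel.lift_ι _ _ _
  let j : cosmash₃ A B D ⟶ kernel ρ := kernel.lift ρ (cosmash₃ToCosmash A B D) (by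
    rw [← cancel_mono (cosmashι _ _), Category.assoc, cosmashMap_ι, reassoc_of% cosmash₃ToCosmash_ι,
      cosmash₃ι_middle, zero_comp])
  have hj : j ≫ kernel.ι ρ = cosmash₃ToCosmash A B D := kernel.lift_ι _ _ _
  have hτ : IsSplitExtension j (kernel.ι ρ ≫ τ) i := by
    have : Mono (j ≫ kernel.ι ρ ≫ cosmashι _ _) := by
      rw [reassoc_of% hj, cosmash₃ToCosmash_ι]; infer_instance
    have : Mono j := mono_of_mono j (kernel.ι ρ ≫ cosmashι _ _)
    refine .of_lift ?_ ?_ fun {T} t ht => ?_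
    · rw [reassoc_of% hi, ← cosmashMap_comp]
      simp [cosmashMap_id]
    · rw [reassoc_of% hj, ← cancel_mono (cosmashι _ _), Category.assoc, cosmashMap_ι,
        reassoc_of% cosmash₃ToCosmash_ι, cosmash₃ι_right, zero_comp]
    · obtain ⟨l, hl⟩ := cosmash₃_exists_lift (t ≫ kernel.ι ρ ≫ cosmashι _ _)
        (by simp [cosmashι_desc_one_zero])
        (by
          have : ρ ≫ cosmashι _ _ = _ := cosmashMap_ι _ _
          rw [Category.assoc, Category.assoc, ← this, kernel.condition_assoc]
          simp)
        (by
          have : τ ≫ cosmashι _ _ = _ := cosmashMap_ι _ _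
          rw [Category.assoc, Category.assoc, ← this]
          rw [reassoc_of% ht, zero_comp])
      refine ⟨l, ?_⟩
      rw [← cancel_mono (kernel.ι ρ), ← cancel_mono (cosmashι _ _), Category.assoc l, hj,
        Category.assoc, cosmash₃ToCosmash_ι, hl, Category.assoc]
  refine hρ.hom_ext (hτ.hom_ext ?_ ?_) h₁
  · rw [reassoc_of% hj, reassoc_of% hj, h₃]
  · rw [reassoc_of% hi, reassoc_of% hi, h₂]

/-- If `[σ, κ] : A + X ⟶ T` induces the action core `ψ`, where `σ` is a section of `π` and `κ` is a
monomorphism into the kernel of `π`, then the image of `[σ, κ]` is a split extension of `A` by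
`X`. -/
lemma exists_isSplitExtension_image {A X T : C} {ψ : cosmash A X ⟶ X} {σ : A ⟶ T} {κ : X ⟶ T}
    {π : T ⟶ A} [Mono κ] (hσ : σ ≫ π = 𝟙 A) (hκ : κ ≫ π = 0)
    (hψ : ψ ≫ κ = cosmashι A X ≫ coprod.desc σ κ) :
    ∃ (G : C) (m : G ⟶ T) (k : X ⟶ G) (s : A ⟶ G), Mono m ∧ k ≫ m = κ ∧ s ≫ m = σ ∧
      IsSplitExtension k (m ≫ π) s := by
  let F := Regular.strongEpiMonoFactorisation (coprod.desc σ κ)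
  have hF : F.e ≫ F.m = coprod.desc σ κ := F.fac
  have hk : (coprod.inr ≫ F.e) ≫ F.m = κ := by rw [Category.assoc, hF]; simp
  have hs : (coprod.inl ≫ F.e) ≫ F.m = σ := by rw [Category.assoc, hF]; simp
  refine ⟨F.I, F.m, coprod.inr ≫ F.e, coprod.inl ≫ F.e, F.m_mono, hk, hs, ?_⟩
  have hp : coprod.desc (𝟙 A) (0 : X ⟶ A) = F.e ≫ F.m ≫ π := by
    rw [reassoc_of% hF]
    ext <;> simp [hσ, hκ]
  have hsπ : (coprod.inl ≫ F.e) ≫ F.m ≫ π = 𝟙 A := by rw [← Category.assoc, hs, hσ]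
  have hkπ : (coprod.inr ≫ F.e) ≫ F.m ≫ π = 0 := by rw [← Category.assoc, hk, hκ]
  let l : X ⟶ kernel (F.m ≫ π) := kernel.lift _ (coprod.inr ≫ F.e) hkπ
  have hl : l ≫ kernel.ι _ = coprod.inr ≫ F.e := kernel.lift_ι _ _ _
  -- The kernel over `A` of the image is covered by `A ♭ X`, which is generated by `A ⋄ X` and `X`.
  -- Both land in `X`, the former through `ψ`, so the kernel is no larger than `X`.
  let e : kernel (coprod.desc (𝟙 A) (0 : X ⟶ A)) ⟶ kernel (F.m ≫ π) :=
    kernel.lift _ (kernel.ι _ ≫ F.e) (by rw [Category.assoc, ← hp, kernel.condition])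
  have he' : e ≫ kernel.ι _ = kernel.ι _ ≫ F.e := kernel.lift_ι _ _ _
  have he : StrongEpi e := strongEpi_kernel (isSplitExtension_coprod A X) (.kernel_ι hsπ) e F.e
    (𝟙 A) he'.symm (by rw [Category.comp_id, hp]) (by simp)
  have : Mono l := by
    have : Mono (l ≫ kernel.ι _ ≫ F.m) := by rwa [reassoc_of% hl, ← Category.assoc, hk]
    exact mono_of_mono l (kernel.ι _ ≫ F.m)
  obtain ⟨r, hr⟩ := (isSplitExtension_cosmashToFlat A X).exists_factor e l ψ (𝟙 X) (by
      rw [← cancel_mono (kernel.ι _), ← cancel_mono F.m, Category.assoc ψ, hl, Category.assoc ψ, hk,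
        hψ, Category.assoc, Category.assoc, reassoc_of% he', reassoc_of% cosmashToFlat_ι, hF]) (by
      rw [← cancel_mono (kernel.ι _), Category.assoc, hl, Category.assoc, he',
        reassoc_of% inrFlat_ι,
        Category.id_comp])
  have : StrongEpi (r ≫ l) := by rwa [hr]
  have : StrongEpi l := strongEpi_of_strongEpi r l
  have : IsIso l := isIso_of_mono_of_strongEpi l
  have : Mono ((coprod.inr : X ⟶ A ⨿ X) ≫ F.e) := by rw [← hl]; infer_instance
  refine .of_lift hsπ hkπ fun t ht => ⟨kernel.lift _ t ht ≫ inv l, ?_⟩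
  rw [← hl, Category.assoc, IsIso.inv_hom_id_assoc, kernel.lift_ι]

/-- The universal property of a semi-direct product. -/
lemma IsSplitExtension.exists_desc {X E A T : C} {k : X ⟶ E} {p : E ⟶ A} {s : A ⟶ E}
    (h : IsSplitExtension k p s) {ψ : cosmash A X ⟶ X}
    (hψ : ψ ≫ k = cosmashι A X ≫ coprod.desc s k) (u : A ⟶ T) (v : X ⟶ T)
    (huv : ψ ≫ v = cosmashι A X ≫ coprod.desc u v) :
    ∃ e : E ⟶ T, k ≫ e = v ∧ s ≫ e = u := by
  have := h.mono
  -- The graph of the desired morphism is the image of `[(s, u), (k, v)]` in `E × T`; by the split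
  -- short five lemma it projects isomorphically onto `E`.
  have : Mono (prod.lift k v) := by
    have : Mono (prod.lift k v ≫ prod.fst) := by rwa [prod.lift_fst]
    exact mono_of_mono (prod.lift k v) prod.fst
  obtain ⟨G, m, k', s', hm, hk, hs, hG⟩ := exists_isSplitExtension_image (ψ := ψ)
    (σ := prod.lift s u) (κ := prod.lift k v) (π := prod.fst ≫ p)
    (by rw [prod.lift_fst_assoc, h.section_comp]) (by rw [prod.lift_fst_assoc, h.comp_zero]) (by
      apply prod.hom_ext
      · simp only [Category.assoc, prod.lift_fst, hψ]
        congr 1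
        ext <;> simp
      · simp only [Category.assoc, prod.lift_snd, huv]
        congr 1
        ext <;> simp)
  have hk₁ : k' ≫ m ≫ prod.fst = k := by rw [reassoc_of% hk, prod.lift_fst]
  have hs₁ : s' ≫ m ≫ prod.fst = s := by rw [reassoc_of% hs, prod.lift_fst]
  have : IsIso (m ≫ prod.fst) := IsSemiAbelian.splitShortFive (𝟙 X) (m ≫ prod.fst) (𝟙 A) hG h
    (by simp [hk₁]) (by simp) (by simp [hs₁]) inferInstance inferInstance
  refine ⟨inv (m ≫ prod.fst) ≫ m ≫ prod.snd, ?_, ?_⟩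
  · rw [← hk₁]
    simp only [Category.assoc, IsIso.hom_inv_id_assoc]
    rw [reassoc_of% hk, prod.lift_snd]
  · rw [← hs₁]
    simp only [Category.assoc, IsIso.hom_inv_id_assoc]
    rw [reassoc_of% hs, prod.lift_snd]

end Cosmash

end SemiAb

namespace SemiAb

/-! ### Folding morphisms, conjugation and kernel pairs. -/

section FoldLemmas

variable {C : Type u} [Category.{v} C] [HasZeroMorphisms C] [IsSemiAbelian C]

attribute [local simp] coprod.inl_desc coprod.inr_desc coprod.inl_desc_assoc coprod.inr_desc_assoc
  prod.lift_fst prod.lift_snd prod.lift_fst_assoc prod.lift_snd_assoc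
  pullback.lift_fst pullback.lift_snd pullback.lift_fst_assoc pullback.lift_snd_assoc

lemma cosmash₃Map_ι {A A' B B' D D' : C} (f : A ⟶ A') (g : B ⟶ B') (h : D ⟶ D') :
    cosmash₃Map f g h ≫ cosmash₃ι A' B' D' =
      cosmash₃ι A B D ≫ coprod.map (coprod.map f g) h :=
  kernel.lift_ι _ _ _

lemma fold₁₂_ι (A B : C) : fold₁₂ A B ≫ cosmashι A B =
    cosmash₃ι A B B ≫ coprod.desc (𝟙 (A ⨿ B)) coprod.inr :=
  kernel.lift_ι _ _ _

lemma fold₂₁_ι (A B : C) : fold₂₁ A B ≫ cosmashι A B =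
    cosmash₃ι A A B ≫ coprod.map (coprod.desc (𝟙 A) (𝟙 A)) (𝟙 B) :=
  kernel.lift_ι _ _ _

lemma cosmashMap_conj {A X : C} (f : X ⟶ A) :
    cosmashMap (𝟙 A) f ≫ conj A = cosmashι A X ≫ coprod.desc (𝟙 A) f := by
  rw [conj, cosmashMap_ι_desc]
  simp

lemma conj_naturality {X Y : C} (f : X ⟶ Y) : conj X ≫ f = cosmashMap f f ≫ conj Y := by
  simp only [conj, cosmashMap_ι_desc, Category.assoc]
  congr 1
  ext <;> simp

lemma strongEpi_desc {X E A : C} {k : X ⟶ E} {p : E ⟶ A} {s : A ⟶ E}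
    (h : IsSplitExtension k p s) : StrongEpi (coprod.desc s k) :=
  strongEpi_of_forall_mono _ fun Z f i _ hf =>
    h.isIso_of_mono i (coprod.inr ≫ f) (coprod.inl ≫ f) (by simp [hf]) (by simp [hf])

/-- The kernel pair of a morphism, as a split extension by the kernel. -/
lemma isSplitExtension_kernelPair {X E B : C} (k : X ⟶ E) (p : E ⟶ B) [Mono k] (hk : k ≫ p = 0)
    (hl : ∀ {T : C} (t : T ⟶ E), t ≫ p = 0 → ∃ l : T ⟶ X, l ≫ k = t) :
    IsSplitExtension (pullback.lift k 0 (by rw [hk, zero_comp]) : X ⟶ pullback p p)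
      (pullback.snd p p) (pullback.lift (𝟙 E) (𝟙 E) rfl) := by
  have : Mono (pullback.lift k 0 (by rw [hk, zero_comp]) : X ⟶ pullback p p) := by
    have : Mono ((pullback.lift k 0 (by rw [hk, zero_comp]) : X ⟶ pullback p p) ≫
        pullback.fst p p) := by rwa [pullback.lift_fst]
    exact mono_of_mono _ (pullback.fst p p)
  refine .of_lift (by simp) (by simp) fun t ht => ?_
  obtain ⟨l, hl⟩ := hl (t ≫ pullback.fst p p) (by
    rw [Category.assoc, pullback.condition, reassoc_of% ht, zero_comp])
  exact ⟨l, by apply pullback.hom_ext <;> simp [hl, ht]⟩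

/-- Conjugation is the action core of the kernel pair, viewed as a split extension along its
diagonal; `exists_desc` can then be applied to kernel pairs. -/
lemma action_kernelPair {X E B : C} {k : X ⟶ E} {p : E ⟶ B} (hk : k ≫ p = 0)
    {χ : cosmash E X ⟶ X} (hχ : χ ≫ k = cosmashι E X ≫ coprod.desc (𝟙 E) k) :
    χ ≫ (pullback.lift k 0 (by rw [hk, zero_comp]) : X ⟶ pullback p p) =
      cosmashι E X ≫ coprod.desc (pullback.lift (𝟙 E) (𝟙 E) rfl)
        (pullback.lift k 0 (by rw [hk, zero_comp])) := by
  apply pullback.hom_ext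
  · simp only [Category.assoc, pullback.lift_fst, hχ]
    congr 1
    ext <;> simp
  · simp only [Category.assoc, pullback.lift_snd, comp_zero]
    rw [← cosmashι_desc_one_zero]
    congr 1
    ext <;> simp

end FoldLemmas

/-! ### Elementary crossed modules and the associated groupoid structure. -/

namespace XMod

variable {C : Type u} [Category.{v} C] [HasZeroMorphisms C] [IsSemiAbelian C]

attribute [local simp] coprod.inl_desc coprod.inr_desc coprod.inl_desc_assoc coprod.inr_desc_assoc
  prod.lift_fst prod.lift_snd prod.lift_fst_assoc prod.lift_snd_assoc
  pullback.lift_fst pullback.lift_snd pullback.lift_fst_assoc pullback.lift_snd_assoc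

@[simp]
lemma comp_fX {M N O : XMod C} (f : M ⟶ N) (g : N ⟶ O) : (f ≫ g).fX = f.fX ≫ g.fX := rfl

@[simp]
lemma comp_fA {M N O : XMod C} (f : M ⟶ N) (g : N ⟶ O) : (f ≫ g).fA = f.fA ≫ g.fA := rfl

@[simp]
lemma zero_fX (M N : XMod C) : Hom.fX (0 : M ⟶ N) = 0 := rfl

@[simp]
lemma zero_fA (M N : XMod C) : Hom.fA (0 : M ⟶ N) = 0 := rfl

lemma hom_ext {M N : XMod C} {f g : M ⟶ N} (hX : f.fX = g.fX) (hA : f.fA = g.fA) : f = g :=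
  Hom.ext hX hA

lemma mono_of_components {M N : XMod C} (f : M ⟶ N) [Mono f.fX] [Mono f.fA] : Mono f where
  right_cancellation g h w := hom_ext
    (by rw [← cancel_mono f.fX]; exact congrArg Hom.fX w)
    (by rw [← cancel_mono f.fA]; exact congrArg Hom.fA w)

lemma act_bd (M : XMod C) : M.act ≫ M.bd = cosmashι M.A M.X ≫ coprod.desc (𝟙 M.A) M.bd := by
  rw [← M.precrossed, cosmashMap_conj]

/-- A morphism to a crossed module with monic boundary is automatically equivariant. -/
def homOfMono {M N : XMod C} [Mono N.bd] (fX : M.X ⟶ N.X) (fA : M.A ⟶ N.A)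
    (h : M.bd ≫ fA = fX ≫ N.bd) : M ⟶ N where
  fX := fX
  fA := fA
  bd_comm := h
  equivariant := by
    rw [← cancel_mono N.bd, Category.assoc, Category.assoc, act_bd, cosmashMap_ι_desc, ← h,
      reassoc_of% act_bd]
    congr 1
    ext <;> simp

open scoped ZeroObject in
/-- The crossed module `0 ⟶ A`. -/
noncomputable def disc (A : C) : XMod C where
  X := 0
  A := A
  act := 0
  bd := 0
  isActionCore := ⟨A, 0, 𝟙 A, 𝟙 A, by
    have : Mono (0 : (0 : C) ⟶ A) := ⟨fun _ _ _ => (isZero_zero C).eq_of_tgt _ _⟩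
    exact .of_lift (by simp) (by simp) fun t ht => ⟨0, by simpa using ht.symm⟩, by
    rw [cosmashι_desc_left_zero, comp_zero]⟩
  precrossed := by rw [cosmashMap_zero_right, zero_comp, comp_zero]
  peiffer := (isZero_zero C).eq_of_tgt _ _
  ternary := (isZero_zero C).eq_of_tgt _ _

open scoped ZeroObject in
/-- Morphisms out of `0 ⟶ A`. -/
noncomputable def discHom {A : C} {N : XMod C} (f : A ⟶ N.A) : disc A ⟶ N where
  fX := 0
  fA := f
  bd_comm := by rw [zero_comp]; exact zero_comp
  equivariant := by
    have h : cosmashMap f (0 : (0 : C) ⟶ N.X) ≫ N.act = 0 := by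
      rw [cosmashMap_zero_right, zero_comp]
    exact comp_zero.trans h.symm

lemma disc_hom_ext {A : C} {N : XMod C} {f g : disc A ⟶ N} (h : f.fA = g.fA) : f = g :=
  hom_ext ((isZero_zero C).eq_of_src _ _) h

/-- The conjugation action of an object on a kernel. -/
noncomputable def kernelConj {A B : C} (q : A ⟶ B) : cosmash A (kernel q) ⟶ kernel q :=
  kernel.lift q (cosmashι A (kernel q) ≫ coprod.desc (𝟙 A) (kernel.ι q)) (by
    have : coprod.desc (𝟙 A) (kernel.ι q) ≫ q = coprod.desc q 0 := by ext <;> simp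
    rw [Category.assoc, this, cosmashι_desc_left_zero])

lemma kernelConj_ι {A B : C} (q : A ⟶ B) :
    kernelConj q ≫ kernel.ι q = cosmashι A (kernel q) ≫ coprod.desc (𝟙 A) (kernel.ι q) :=
  kernel.lift_ι _ _ _

/-- The inclusion of a kernel is a crossed module. -/
noncomputable def ofKernel {A B : C} (q : A ⟶ B) : XMod C where
  X := kernel q
  A := A
  act := kernelConj q
  bd := kernel.ι q
  isActionCore := ⟨pullback q q, _, _, _, isSplitExtension_kernelPair (kernel.ι q) q
    (kernel.condition q) (fun t ht => ⟨kernel.lift q t ht, kernel.lift_ι _ _ _⟩),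
    action_kernelPair (kernel.condition q) (kernelConj_ι q)⟩
  precrossed := by rw [kernelConj_ι, cosmashMap_conj]
  peiffer := by
    rw [← cancel_mono (kernel.ι q), Category.assoc, kernelConj_ι, cosmashMap_ι_desc, conj,
      Category.assoc]
    congr 1
    ext <;> simp
  ternary := by
    rw [← cancel_mono (kernel.ι q)]
    simp only [Category.assoc, kernelConj_ι]
    rw [reassoc_of% fold₁₂_ι, reassoc_of% fold₂₁_ι, reassoc_of% cosmash₃Map_ι]
    congr 1
    ext <;> simp

instance {A B : C} (q : A ⟶ B) : Mono (ofKernel q).bd :=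
  inferInstanceAs (Mono (kernel.ι q))

/-- The division of the internal groupoid corresponding to a crossed module: there are a split
extension `X ⟶ E ⇄ A` with the given action, a codomain morphism `c` and a morphism `d`, thought of
as `(y, z) ↦ y z⁻¹`. -/
lemma exists_division (M : XMod C) :
    ∃ (E : C) (k : M.X ⟶ E) (p : E ⟶ M.A) (s : M.A ⟶ E) (c : E ⟶ M.A) (d : pullback p p ⟶ E)
      (h : IsSplitExtension k p s), M.act ≫ k = cosmashι M.A M.X ≫ coprod.desc s k ∧
      k ≫ c = M.bd ∧ s ≫ c = 𝟙 M.A ∧ pullback.lift (𝟙 E) (𝟙 E) rfl ≫ d = c ≫ s ∧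
      pullback.lift k 0 (by rw [h.comp_zero, zero_comp]) ≫ d = k := by
  obtain ⟨E, k, p, s, h, hact⟩ := M.isActionCore
  have := h.mono
  obtain ⟨c, hkc, hsc⟩ := h.exists_desc hact (𝟙 M.A) M.bd M.act_bd
  -- `χ` is the conjugation action of `E` on its normal subobject `X`.
  obtain ⟨χ, hχ⟩ := h.exists_lift (cosmashι E M.X ≫ coprod.desc (𝟙 E) k) (by
    have : coprod.desc (𝟙 E) k ≫ p = coprod.desc p 0 := by ext <;> simp [h.comp_zero]
    rw [Category.assoc, this, cosmashι_desc_left_zero])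
  -- Conjugation by `E` depends only on the codomain. As `A + X` covers `E`, this is tested on `(A +
  -- X) ⋄ X`: the piece `A ⋄ X` is the definition of the action, `X ⋄ X` the Peiffer condition and
  -- `A ⋄ X ⋄ X` the ternary condition.
  have hχc : χ = cosmashMap c (𝟙 M.X) ≫ M.act := by
    have := strongEpi_desc h
    rw [← cancel_epi (cosmashMap (coprod.desc s k) (𝟙 M.X))]
    apply cosmash_coprod_hom_ext
    · rw [← cancel_mono k]
      simp only [Category.assoc, hχ, hact, cosmashMap_ι_desc]
      congr 1
      ext <;> simp [reassoc_of% hsc]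
    · have h₁ : cosmashMap k (𝟙 M.X) ≫ χ = conj M.X := by
        rw [← cancel_mono k, Category.assoc, hχ, cosmashMap_ι_desc, conj, Category.assoc]
        congr 1
        ext <;> simp
      rw [← Category.assoc, ← cosmashMap_comp, ← Category.assoc, ← Category.assoc,
        ← cosmashMap_comp, ← cosmashMap_comp]
      simp [h₁, hkc, M.peiffer]
    · have h₁ : cosmash₃ToCosmash M.A M.X M.X ≫ cosmashMap (coprod.desc (𝟙 M.A) M.bd) (𝟙 M.X) =
          cosmash₃Map (𝟙 M.A) M.bd (𝟙 M.X) ≫ fold₂₁ M.A M.X := by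
        rw [← cancel_mono (cosmashι _ _), Category.assoc, Category.assoc, cosmashMap_ι, fold₂₁_ι,
          reassoc_of% cosmash₃ToCosmash_ι, reassoc_of% cosmash₃Map_ι]
        congr 1
        ext <;> simp
      have h₂ : coprod.desc s k ≫ c = coprod.desc (𝟙 M.A) M.bd := by ext <;> simp [hkc, hsc]
      rw [← Category.assoc (cosmashMap _ _) (cosmashMap _ _), ← cosmashMap_comp, h₂,
        Category.comp_id, reassoc_of% h₁, ← M.ternary, ← cancel_mono k]
      simp only [Category.assoc, hχ, hact, cosmashMap_ι_desc]
      rw [reassoc_of% cosmash₃ToCosmash_ι, reassoc_of% fold₁₂_ι]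
      congr 1
      ext <;> simp
  obtain ⟨d, hd₁, hd₂⟩ := (isSplitExtension_kernelPair k p h.comp_zero h.exists_lift).exists_desc
    (action_kernelPair h.comp_zero hχ) (c ≫ s) k (by
      rw [hχc, Category.assoc, hact, cosmashMap_ι_desc, Category.id_comp])
  exact ⟨E, k, p, s, c, d, h, hact, hkc, hsc, hd₂, hd₁⟩

/-! ### Free crossed modules. -/

/-- The free crossed module on a pair of objects. -/
noncomputable def free (Q X : C) : XMod C :=
  ofKernel (coprod.desc (𝟙 Q) (0 : X ⟶ Q))

/-- The inclusion of `Q` into the free crossed module on `(Q, X)`. -/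
noncomputable def freeInl (Q X : C) : Q ⟶ (free Q X).A :=
  (coprod.inl : Q ⟶ Q ⨿ X)

/-- The inclusion of `X` into the free crossed module on `(Q, X)`. -/
noncomputable def freeInr (Q X : C) : X ⟶ (free Q X).X :=
  inrFlat Q X

instance (Q X : C) : Mono (free Q X).bd :=
  inferInstanceAs (Mono (kernel.ι (coprod.desc (𝟙 Q) (0 : X ⟶ Q))))

lemma freeInr_bd (Q X : C) : freeInr Q X ≫ (free Q X).bd = (coprod.inr : X ⟶ Q ⨿ X) :=
  inrFlat_ι Q X

/-- The generators define `h : Q + X ⟶ E` into the semi-direct product of `N`. Its codomain part `h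
≫ c` is the component on objects `A`, and its restriction to `Q ♭ X` lands in `N.X`. -/
lemma exists_free_hom {Q X : C} {N : XMod C} (gQ : Q ⟶ N.A) (gX : X ⟶ N.X) :
    ∃ g : free Q X ⟶ N, freeInl Q X ≫ g.fA = gQ ∧ freeInr Q X ≫ g.fX = gX := by
  obtain ⟨E, k, p, s, c, d, hE, hact, hkc, hsc, hd₁, hd₂⟩ := N.exists_division
  have := hE.mono
  let r : Q ⨿ X ⟶ Q := coprod.desc (𝟙 Q) 0
  let h : Q ⨿ X ⟶ E := coprod.desc (gQ ≫ s) (gX ≫ k)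
  have hp : h ≫ p = r ≫ gQ := by ext <;> simp [h, r, hE.section_comp, hE.comp_zero]
  have hrp : kernel.ι r ≫ h ≫ p = 0 := by rw [hp, kernel.condition_assoc, zero_comp]
  obtain ⟨fX, hfX⟩ := hE.exists_lift (kernel.ι r ≫ h) (by rw [Category.assoc, hrp])
  -- Equivariance comes from division: `δ ≫ d` is a single morphism on the kernel pair of `r` which
  -- is `h ≫ c ≫ s` on the diagonal and `fX ≫ k` on the kernel, so it carries conjugation to the
  -- action of `N`.
  let δ : pullback r r ⟶ pullback p p :=
    pullback.lift (pullback.fst r r ≫ h) (pullback.snd r r ≫ h)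
      (by simp only [Category.assoc, hp, pullback.condition_assoc])
  have hδ₁ : pullback.lift (𝟙 (Q ⨿ X)) (𝟙 (Q ⨿ X)) rfl ≫ δ ≫ d = (h ≫ c) ≫ s := by
    have : pullback.lift (𝟙 (Q ⨿ X)) (𝟙 (Q ⨿ X)) rfl ≫ δ = h ≫ pullback.lift (𝟙 E) (𝟙 E) rfl := by
      apply pullback.hom_ext <;> simp [δ]
    rw [Category.assoc, ← hd₁, reassoc_of% this]
  have hδ₂ : pullback.lift (kernel.ι r) 0 (by rw [kernel.condition, zero_comp]) ≫ δ ≫ d =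
      fX ≫ k := by
    have : pullback.lift (kernel.ι r) 0 (by rw [kernel.condition, zero_comp]) ≫ δ =
        fX ≫ pullback.lift k 0 (by rw [hE.comp_zero, zero_comp]) := by
      apply pullback.hom_ext <;> simp [hfX, δ]
    rw [reassoc_of% this, hd₂]
  have hfX' : kernelConj r ≫ fX = cosmashMap (h ≫ c) fX ≫ N.act := by
    rw [← cancel_mono k, Category.assoc, Category.assoc, hact, cosmashMap_ι_desc, ← hδ₁, ← hδ₂,
      reassoc_of% action_kernelPair (kernel.condition r) (kernelConj_ι r)]
    congr 1
    ext <;> simp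
  refine ⟨⟨fX, h ≫ c, ?_, hfX'⟩, ?_, ?_⟩
  · change kernel.ι r ≫ h ≫ c = fX ≫ N.bd
    rw [← hkc, reassoc_of% hfX]
  · change coprod.inl ≫ h ≫ c = gQ
    simp [h, hsc]
  · change inrFlat Q X ≫ fX = gX
    rw [← cancel_mono k, Category.assoc, hfX, reassoc_of% inrFlat_ι]
    simp [h]

/-- On `Q + X`, the value on the summand `X` is forced by the boundary. On `Q ♭ X`, generated by `Q
⋄ X` and `X`, the value on `Q ⋄ X` is forced by equivariance. -/
lemma free_hom_ext {Q X : C} {N : XMod C} {f g : free Q X ⟶ N}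
    (hQ : freeInl Q X ≫ f.fA = freeInl Q X ≫ g.fA)
    (hX : freeInr Q X ≫ f.fX = freeInr Q X ≫ g.fX) : f = g := by
  have hA : f.fA = g.fA := by
    refine coprod.hom_ext hQ ?_
    have := hX =≫ N.bd
    rw [Category.assoc, Category.assoc, ← f.bd_comm, ← g.bd_comm] at this
    rw [← Category.assoc, ← Category.assoc] at this
    exact (congrArg (· ≫ f.fA) (freeInr_bd Q X)).symm.trans
      (this.trans (congrArg (· ≫ g.fA) (freeInr_bd Q X)))
  refine hom_ext ?_ hA
  refine (isSplitExtension_cosmashToFlat Q X).hom_ext ?_ hX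
  have h₁ : cosmashToFlat Q X = cosmashMap coprod.inl (inrFlat Q X) ≫ kernelConj _ := by
    rw [← cancel_mono (kernel.ι _), cosmashToFlat_ι, Category.assoc, kernelConj_ι,
      cosmashMap_ι_desc, inrFlat_ι, Category.comp_id]
    refine (Category.comp_id _).symm.trans (congrArg _ ?_)
    ext <;> simp
  have h₂ (f : free Q X ⟶ N) : (cosmashMap (freeInl Q X) (freeInr Q X) ≫ (free Q X).act) ≫ f.fX =
      cosmashMap (freeInl Q X ≫ f.fA) (freeInr Q X ≫ f.fX) ≫ N.act := by
    rw [Category.assoc, f.equivariant, ← Category.assoc, ← cosmashMap_comp]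
  refine (congrArg (· ≫ f.fX) h₁).trans (Eq.trans ?_ (congrArg (· ≫ g.fX) h₁).symm)
  exact (h₂ f).trans (Eq.trans (by rw [hQ, hX]) (h₂ g).symm)

/-! ### Components of regular epimorphisms. -/

section RegularEpis

/-- The restriction of a crossed module to a subobject of `X` which is stable under the action. -/
def restrict (N : XMod C) {I : C} (j : I ⟶ N.X) [Mono j] (ψ : cosmash N.A I ⟶ I)
    (hψ : ψ ≫ j = cosmashMap (𝟙 N.A) j ≫ N.act) : XMod C where
  X := I
  A := N.A
  act := ψ
  bd := j ≫ N.bd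
  isActionCore := by
    obtain ⟨E, k, p, s, h, hact⟩ := N.isActionCore
    have := h.mono
    have hj : ψ ≫ j ≫ k = cosmashι N.A I ≫ coprod.desc s (j ≫ k) := by
      rw [reassoc_of% hψ, hact, cosmashMap_ι_desc, Category.id_comp]
    obtain ⟨G, m, k', s', hm, hk, hs, hG⟩ := exists_isSplitExtension_image h.section_comp
      (by rw [Category.assoc, h.comp_zero, comp_zero]) hj
    refine ⟨G, k', m ≫ p, s', hG, ?_⟩
    rw [← cancel_mono m, Category.assoc, hk, hj, Category.assoc]
    congr 1
    ext <;> simp [hk, hs]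
  precrossed := by
    rw [reassoc_of% hψ, act_bd, cosmashMap_conj, cosmashMap_ι_desc, Category.id_comp]
  peiffer := by
    rw [← cancel_mono j, Category.assoc, hψ, ← Category.assoc, ← cosmashMap_comp, conj_naturality,
      ← N.peiffer, ← Category.assoc, ← cosmashMap_comp]
    simp
  ternary := by
    have h₁ : fold₁₂ N.A I ≫ cosmashMap (𝟙 N.A) j =
        cosmash₃Map (𝟙 N.A) j j ≫ fold₁₂ N.A N.X := by
      rw [← cancel_mono (cosmashι _ _), Category.assoc, cosmashMap_ι, reassoc_of% fold₁₂_ι,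
        Category.assoc, fold₁₂_ι, reassoc_of% cosmash₃Map_ι]
      congr 1
      ext <;> simp
    have h₂ : cosmash₃Map (𝟙 N.A) (j ≫ N.bd) (𝟙 I) ≫ fold₂₁ N.A I ≫ cosmashMap (𝟙 N.A) j =
        cosmash₃Map (𝟙 N.A) j j ≫ cosmash₃Map (𝟙 N.A) N.bd (𝟙 N.X) ≫ fold₂₁ N.A N.X := by
      rw [← cancel_mono (cosmashι _ _)]
      simp only [Category.assoc]
      rw [cosmashMap_ι, reassoc_of% fold₂₁_ι, fold₂₁_ι, reassoc_of% cosmash₃Map_ι,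
        reassoc_of% cosmash₃Map_ι,
        reassoc_of% cosmash₃Map_ι]
      congr 1
      ext <;> simp
    rw [← cancel_mono j]
    simp only [Category.assoc, hψ]
    rw [reassoc_of% h₁, N.ternary, reassoc_of% h₂]

/-- The inclusion of the restriction of a crossed module. -/
def restrictHom (N : XMod C) {I : C} (j : I ⟶ N.X) [Mono j] (ψ : cosmash N.A I ⟶ I)
    (hψ : ψ ≫ j = cosmashMap (𝟙 N.A) j ≫ N.act) : N.restrict j ψ hψ ⟶ N where
  fX := j
  fA := 𝟙 N.A
  bd_comm := Category.comp_id _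
  equivariant := hψ

/-- The functor `M ↦ M.A` has a right adjoint, sending `U` to the identity crossed module on `U`
(here the kernel of `0 : U ⟶ U`), so it preserves coequalizers. -/
lemma strongEpi_fA {M N : XMod C} (e : M ⟶ N) [IsRegularEpi e] : StrongEpi e.fA := by
  let W := IsRegularEpi.W e
  have hw : (IsRegularEpi.left e).fA ≫ e.fA = (IsRegularEpi.right e).fA ≫ e.fA :=
    congrArg Hom.fA (IsRegularEpi.w e)
  let hom {M : XMod C} {U : C} (t : M.A ⟶ U) : M ⟶ ofKernel (0 : U ⟶ U) :=
    homOfMono (kernel.lift 0 (M.bd ≫ t) comp_zero) t (kernel.lift_ι _ _ _).symm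
  have hom_ext' {M : XMod C} {U : C} {f g : M ⟶ ofKernel (0 : U ⟶ U)} (h : f.fA = g.fA) :
      f = g := hom_ext (by
    rw [← cancel_mono (ofKernel (0 : U ⟶ U)).bd, ← f.bd_comm, ← g.bd_comm, h]) h
  have : IsRegularEpi e.fA := by
    refine ⟨⟨W.A, (IsRegularEpi.left e).fA, (IsRegularEpi.right e).fA, hw,
      Cofork.IsColimit.ofExistsUnique fun s => ?_⟩⟩
    have hs : IsRegularEpi.left e ≫ hom s.π = IsRegularEpi.right e ≫ hom s.π :=
      hom_ext' s.condition
    refine ⟨(IsRegularEpi.desc e (hom s.π) hs).fA,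
      congrArg Hom.fA (IsRegularEpi.fac e (hom s.π) hs), fun m hm => ?_⟩
    have hm' : hom m = IsRegularEpi.desc e (hom s.π) hs :=
      IsRegularEpi.uniq e (hom s.π) hs (hom m) (hom_ext' hm)
    exact congrArg Hom.fA hm'
  infer_instance

/-- The image of `e.fX` carries a crossed submodule of `N` through which `e` factors; a strong
epimorphism admits no proper one. -/
lemma strongEpi_fX {M N : XMod C} (e : M ⟶ N) [IsRegularEpi e] : StrongEpi e.fX := by
  have := strongEpi_fA e
  let F := Regular.strongEpiMonoFactorisation e.fX
  have hF : F.e ≫ F.m = e.fX := F.fac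
  -- The diagonal of this square is the action on the image; it exists because cosmash products
  -- preserve strong epimorphisms.
  have sq : CommSq (M.act ≫ F.e) (cosmashMap e.fA F.e) F.m (cosmashMap (𝟙 N.A) F.m ≫ N.act) := ⟨by
    rw [Category.assoc, hF, e.equivariant, ← Category.assoc, ← cosmashMap_comp, hF,
      Category.comp_id]⟩
  let ι := N.restrictHom F.m sq.lift sq.fac_right
  let g : M ⟶ N.restrict F.m sq.lift sq.fac_right :=
    ⟨F.e, e.fA, by
      change M.bd ≫ e.fA = F.e ≫ F.m ≫ N.bd
      rw [reassoc_of% hF, e.bd_comm], sq.fac_left.symm⟩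
  have hg : g ≫ ι = e := hom_ext hF (Category.comp_id _)
  have : Mono ι.fX := F.m_mono
  have : Mono ι.fA := inferInstanceAs (Mono (𝟙 N.A))
  have : Mono ι := mono_of_components ι
  have : StrongEpi (g ≫ ι) := by rw [hg]; infer_instance
  have : StrongEpi ι := strongEpi_of_strongEpi g ι
  have : IsIso ι := isIso_of_mono_of_strongEpi ι
  have : IsIso F.m := ⟨(inv ι).fX, congrArg Hom.fX (IsIso.hom_inv_id ι),
    congrArg Hom.fX (IsIso.inv_hom_id ι)⟩
  rw [← hF]
  infer_instance

end RegularEpis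

end XMod

end SemiAb

/-! ### Projective crossed modules and the two implications. -/

namespace SemiAb

/-- Every object is a regular quotient of a projective object. -/
def EnoughRegProjectives (D : Type u) [Category.{v} D] : Prop :=
  ∀ X : D, ∃ (P : D) (e : P ⟶ X), IsRegProjective P ∧ IsRegularEpi e

lemma IsRegProjective.of_retract {D : Type u} [Category.{v} D] {P R : D} (hP : IsRegProjective P)
    (i : R ⟶ P) (r : P ⟶ R) (hir : i ≫ r = 𝟙 R) : IsRegProjective R := by
  intro X Y e f he
  obtain ⟨g, hg⟩ := hP e (r ≫ f) he
  exact ⟨i ≫ g, by rw [Category.assoc, hg, reassoc_of% hir]⟩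

section Projectives

variable {C : Type u} [Category.{v} C] [HasZeroMorphisms C] [IsSemiAbelian C]

attribute [local simp] coprod.inl_desc coprod.inr_desc coprod.inl_desc_assoc coprod.inr_desc_assoc

lemma IsRegProjective.exists_lift {P X Y : C} (hP : IsRegProjective P) (e : X ⟶ Y) [StrongEpi e]
    (f : P ⟶ Y) : ∃ g : P ⟶ X, g ≫ e = f :=
  hP e f (isRegularEpi_of_strongEpi e)

lemma IsRegProjective.coprod {P Q : C} (hP : IsRegProjective P) (hQ : IsRegProjective Q) :
    IsRegProjective (P ⨿ Q) := by
  intro X Y e f he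
  obtain ⟨g, hg⟩ := hP e (coprod.inl ≫ f) he
  obtain ⟨h, hh⟩ := hQ e (coprod.inr ≫ f) he
  exact ⟨coprod.desc g h, by ext <;> simp [hg, hh]⟩

lemma exists_desc_of_kernelPair {X Y Z : C} (e : X ⟶ Y) [StrongEpi e] (f : X ⟶ Z)
    (h : pullback.fst e e ≫ f = pullback.snd e e ≫ f) : ∃ g : Y ⟶ Z, e ≫ g = f := by
  have := isRegularEpi_of_strongEpi e
  refine ⟨IsRegularEpi.desc e f ?_, IsRegularEpi.fac e f _⟩
  have := pullback.lift (IsRegularEpi.left e) (IsRegularEpi.right e) (IsRegularEpi.w e) ≫= h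
  simpa [pullback.lift_fst_assoc, pullback.lift_snd_assoc] using this

namespace XMod

/-- `e` is the coequalizer of two morphisms from the free crossed module on the kernel pairs of its
components. The induced components commute with boundaries and actions because `e.fX` and
`cosmashMap e.fA e.fX` are epic. -/
lemma isRegularEpi_of_components {M N : XMod C} (e : M ⟶ N) [StrongEpi e.fX] [StrongEpi e.fA] :
    IsRegularEpi e := by
  obtain ⟨a, haA, haX⟩ := exists_free_hom (N := M) (pullback.fst e.fA e.fA)
    (pullback.fst e.fX e.fX)
  obtain ⟨b, hbA, hbX⟩ := exists_free_hom (N := M) (pullback.snd e.fA e.fA)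
    (pullback.snd e.fX e.fX)
  have hab : a ≫ e = b ≫ e := free_hom_ext
    (by simp only [comp_fA, reassoc_of% haA, reassoc_of% hbA, pullback.condition])
    (by simp only [comp_fX, reassoc_of% haX, reassoc_of% hbX, pullback.condition])
  refine ⟨⟨_, a, b, hab, Cofork.IsColimit.ofExistsUnique fun s => ?_⟩⟩
  have hsA : pullback.fst e.fA e.fA ≫ s.π.fA = pullback.snd e.fA e.fA ≫ s.π.fA := by
    rw [← haA, ← hbA, Category.assoc, Category.assoc]
    exact congrArg (fun t => _ ≫ Hom.fA t) s.condition
  have hsX : pullback.fst e.fX e.fX ≫ s.π.fX = pullback.snd e.fX e.fX ≫ s.π.fX := by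
    rw [← haX, ← hbX, Category.assoc, Category.assoc]
    exact congrArg (fun t => _ ≫ Hom.fX t) s.condition
  obtain ⟨gA, hgA⟩ := exists_desc_of_kernelPair e.fA s.π.fA hsA
  obtain ⟨gX, hgX⟩ := exists_desc_of_kernelPair e.fX s.π.fX hsX
  let g : N ⟶ s.pt := ⟨gX, gA, by
    rw [← cancel_epi e.fX, ← reassoc_of% e.bd_comm, hgA, reassoc_of% hgX, s.π.bd_comm], by
    rw [← cancel_epi (cosmashMap e.fA e.fX), ← reassoc_of% e.equivariant, hgX, s.π.equivariant,
      ← Category.assoc, ← cosmashMap_comp, hgA, hgX]⟩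
  refine ⟨g, hom_ext hgX hgA, fun m hm => hom_ext ?_ ?_⟩
  · rw [← cancel_epi e.fX]
    exact (congrArg Hom.fX hm).trans hgX.symm
  · rw [← cancel_epi e.fA]
    exact (congrArg Hom.fA hm).trans hgA.symm

lemma isRegProjective_free {Q X : C} (hQ : IsRegProjective Q) (hX : IsRegProjective X) :
    IsRegProjective (free Q X) := by
  intro M N e f he
  have := strongEpi_fA e
  have := strongEpi_fX e
  obtain ⟨gQ, hgQ⟩ := hQ.exists_lift e.fA (freeInl Q X ≫ f.fA)
  obtain ⟨gX, hgX⟩ := hX.exists_lift e.fX (freeInr Q X ≫ f.fX)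
  obtain ⟨g, hgA', hgX'⟩ := exists_free_hom gQ gX
  exact ⟨g, free_hom_ext (by simp [reassoc_of% hgA', hgQ]) (by simp [reassoc_of% hgX', hgX])⟩

/-- The cokernel of the boundary of a free crossed module. -/
noncomputable def freeProj (Q X : C) : (free Q X).A ⟶ Q :=
  coprod.desc (𝟙 Q) (0 : X ⟶ Q)

lemma isSplitExtension_free (Q X : C) :
    IsSplitExtension (free Q X).bd (freeProj Q X) (freeInl Q X) :=
  isSplitExtension_coprod Q X

/-- A crossed module whose boundary is the kernel of a split epimorphism is projective as soon as
the kernel, the total object and the quotient are. -/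
lemma isRegProjective_of_isSplitExtension {M : XMod C} {Q : C} {q : M.A ⟶ Q} {s : Q ⟶ M.A}
    (h : IsSplitExtension M.bd q s) (hX : IsRegProjective M.X) (hA : IsRegProjective M.A)
    (hQ : IsRegProjective Q) : IsRegProjective M := by
  have := h.mono
  obtain ⟨ε, hεA, hεX⟩ := exists_free_hom s (𝟙 M.X)
  have hεq : ε.fA ≫ q = freeProj Q M.X := by
    refine (isSplitExtension_free Q M.X).hom_ext ?_ ?_
    · rw [(isSplitExtension_free Q M.X).comp_zero, reassoc_of% ε.bd_comm, h.comp_zero, comp_zero]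
    · rw [(isSplitExtension_free Q M.X).section_comp, reassoc_of% hεA, h.section_comp]
  -- `M.A` is generated by the kernel `M.X` and the section `s`, both in the image of `ε.fA`.
  have : StrongEpi ε.fA := strongEpi_of_forall_mono _ fun Z f i _ hf =>
    h.isIso_of_mono i (freeInr Q M.X ≫ (free Q M.X).bd ≫ f) (freeInl Q M.X ≫ f)
      (by simp only [Category.assoc, hf, ε.bd_comm, reassoc_of% hεX])
      (by simp only [Category.assoc, hf, hεA])
  obtain ⟨σ, hσ⟩ := hA.exists_lift ε.fA (𝟙 M.A)
  -- The section `σ` lies over `Q` by `hεq`, so it restricts to kernels and exhibits `M` as a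
  -- retract of `free Q M.X`.
  obtain ⟨l, hl⟩ := (isSplitExtension_free Q M.X).exists_lift (M.bd ≫ σ) (by
    rw [Category.assoc, ← hεq, reassoc_of% hσ, h.comp_zero])
  refine (isRegProjective_free hQ hX).of_retract (homOfMono l σ hl.symm) ε (hom_ext ?_ hσ)
  rw [← cancel_mono M.bd]
  change (l ≫ ε.fX) ≫ M.bd = 𝟙 _ ≫ M.bd
  rw [Category.assoc, ← ε.bd_comm, reassoc_of% hl, hσ, Category.comp_id, Category.id_comp]

/-- The boundary of a projective crossed module is the kernel of a split epimorphism with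
projective codomain. -/
lemma IsRegProjective.exists_isSplitExtension (hC : EnoughRegProjectives C) {M : XMod C}
    (hM : IsRegProjective M) : ∃ (Q : C) (q : M.A ⟶ Q) (s : Q ⟶ M.A),
      IsSplitExtension M.bd q s ∧ IsRegProjective M.A ∧ IsRegProjective Q := by
  obtain ⟨P, eA, hP, _⟩ := hC M.A
  obtain ⟨X, eX, hX, _⟩ := hC M.X
  obtain ⟨ε, hεA, hεX⟩ := exists_free_hom eA eX
  have : StrongEpi (freeInl P X ≫ ε.fA) := by rw [hεA]; infer_instance
  have : StrongEpi ε.fA := strongEpi_of_strongEpi (freeInl P X) _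
  have : StrongEpi (freeInr P X ≫ ε.fX) := by rw [hεX]; infer_instance
  have : StrongEpi ε.fX := strongEpi_of_strongEpi (freeInr P X) _
  obtain ⟨σ, hσ⟩ := hM ε (𝟙 M) (isRegularEpi_of_components ε)
  have hσA : σ.fA ≫ ε.fA = 𝟙 M.A := congrArg Hom.fA hσ
  have hF := isSplitExtension_free P X
  -- The idempotent `ε ≫ σ` of `free P X` induces `t` on the quotient `P`. Splitting `t` through the
  -- equalizer of `t` and `𝟙 P` gives the required `Q`, a retract of `P`.
  let t : P ⟶ P := freeInl P X ≫ ε.fA ≫ σ.fA ≫ freeProj P X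
  have ht : freeProj P X ≫ t = ε.fA ≫ σ.fA ≫ freeProj P X := by
    refine hF.hom_ext ?_ ?_
    · rw [reassoc_of% hF.comp_zero, zero_comp, reassoc_of% ε.bd_comm, reassoc_of% σ.bd_comm,
        hF.comp_zero, comp_zero, comp_zero]
    · rw [reassoc_of% hF.section_comp]
  have hσt : σ.fA ≫ freeProj P X ≫ t = σ.fA ≫ freeProj P X := by rw [ht, reassoc_of% hσA]
  have htt : t ≫ t = t := by
    change (freeInl P X ≫ ε.fA ≫ σ.fA ≫ freeProj P X) ≫ t = _
    simp only [Category.assoc, hσt, t]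
  let π : P ⟶ equalizer t (𝟙 P) := equalizer.lift t (by rw [htt, Category.comp_id])
  have hπι : π ≫ equalizer.ι t (𝟙 P) = t := equalizer.lift_ι _ _
  have hιt : equalizer.ι t (𝟙 P) ≫ t = equalizer.ι t (𝟙 P) := by
    rw [equalizer.condition, Category.comp_id]
  have hιπ : equalizer.ι t (𝟙 P) ≫ π = 𝟙 _ := by
    rw [← cancel_mono (equalizer.ι t (𝟙 P)), Category.assoc, hπι, hιt, Category.id_comp]
  have htπ : t ≫ π = π := by
    rw [← cancel_mono (equalizer.ι t (𝟙 P)), Category.assoc, hπι, htt]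
  have : Mono M.bd := by
    have : Mono σ.fX := ⟨fun a b hab => by
      have := hab =≫ ε.fX
      have hσX : σ.fX ≫ ε.fX = 𝟙 M.X := congrArg Hom.fX hσ
      simpa [hσX] using this⟩
    have : Mono (M.bd ≫ σ.fA) := by rw [σ.bd_comm]; infer_instance
    exact mono_of_mono M.bd σ.fA
  refine ⟨equalizer t (𝟙 P), σ.fA ≫ freeProj P X ≫ π, equalizer.ι t (𝟙 P) ≫ freeInl P X ≫ ε.fA,
    .of_lift ?_ ?_ fun f hf => ?_, ?_, hP.of_retract _ _ hιπ⟩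
  · have : freeInl P X ≫ ε.fA ≫ σ.fA ≫ freeProj P X ≫ π = t ≫ π := by
      simp only [t, Category.assoc]
    simp only [Category.assoc]
    rw [this, htπ, hιπ]
  · rw [reassoc_of% σ.bd_comm, reassoc_of% hF.comp_zero, zero_comp, comp_zero]
  · obtain ⟨l, hl⟩ := hF.exists_lift (f ≫ σ.fA) (by
      have := hf =≫ equalizer.ι t (𝟙 P)
      simp only [Category.assoc, hπι, hσt, zero_comp] at this
      rw [Category.assoc, this])
    exact ⟨l ≫ ε.fX, by
      rw [Category.assoc, ← ε.bd_comm, reassoc_of% hl, hσA, Category.comp_id]⟩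
  · exact (hP.coprod hX).of_retract σ.fA ε.fA hσA

/-- Morphisms `T ⟶ M.A` are morphisms `disc T ⟶ M`, so the kernel property can be tested there. -/
lemma isSplitExtension_fA {K M N : XMod C} {k : K ⟶ M} {f : M ⟶ N} {s : N ⟶ M}
    (h : IsSplitExtension k f s) : IsSplitExtension k.fA f.fA s.fA := by
  have := h.mono
  have : Mono k.fA := ⟨fun a b hab => by
    have : (discHom a : _ ⟶ K) = discHom b := by
      rw [← cancel_mono k]
      exact disc_hom_ext hab
    exact congrArg Hom.fA this⟩
  refine .of_lift (congrArg Hom.fA h.section_comp) (congrArg Hom.fA h.comp_zero) fun t ht => ?_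
  obtain ⟨l, hl⟩ := h.exists_lift (discHom t) (disc_hom_ext ht)
  exact ⟨l.fA, congrArg Hom.fA hl⟩

lemma isSplitExtension_fX {K M N : XMod C} {k : K ⟶ M} {f : M ⟶ N} {s : N ⟶ M}
    (h : IsSplitExtension k f s) : IsSplitExtension k.fX f.fX s.fX := by
  have := h.mono
  have : Mono k.fX := ⟨fun {T} a b hab => by
    -- Morphisms `T ⟶ K.X` are represented by morphisms from `free T T` vanishing on the first
    -- generator.
    obtain ⟨a', haA, haX⟩ := exists_free_hom (0 : T ⟶ K.A) a
    obtain ⟨b', hbA, hbX⟩ := exists_free_hom (0 : T ⟶ K.A) b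
    have : a' = b' := by
      rw [← cancel_mono k]
      exact free_hom_ext (by simp [reassoc_of% haA, reassoc_of% hbA])
        (by simp [reassoc_of% haX, reassoc_of% hbX, hab])
    rw [← haX, ← hbX, this]⟩
  refine .of_lift (congrArg Hom.fX h.section_comp) (congrArg Hom.fX h.comp_zero)
    fun {T} t ht => ?_
  obtain ⟨t', htA, htX⟩ := exists_free_hom (0 : T ⟶ M.A) t
  obtain ⟨l, hl⟩ := h.exists_lift t' (free_hom_ext (by simp [reassoc_of% htA])
    (by simp [reassoc_of% htX, ht]))
  exact ⟨freeInr T T ≫ l.fX, by rw [Category.assoc, ← comp_fX, hl, htX]⟩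

/-- `disc` is fully faithful and left adjoint to `M ↦ M.A`, and both functors preserve regular
epimorphisms. -/
lemma isRegProjective_disc_iff {A : C} : IsRegProjective (disc A) ↔ IsRegProjective A := by
  refine ⟨fun h X Y e f he => ?_, fun h M N e f he => ?_⟩
  · let e' : disc X ⟶ disc Y := discHom e
    have : StrongEpi e'.fA := strongEpi_of_isRegularEpi e
    have : IsIso e'.fX := ⟨0, (isZero_zero C).eq_of_src _ _, (isZero_zero C).eq_of_src _ _⟩
    obtain ⟨g, hg⟩ := h e' (discHom f) (isRegularEpi_of_components e')
    exact ⟨g.fA, congrArg Hom.fA hg⟩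
  · have := strongEpi_fA e
    obtain ⟨g, hg⟩ := h.exists_lift e.fA f.fA
    exact ⟨discHom g, disc_hom_ext hg⟩

open scoped ZeroObject in
lemma isSplitExtension_disc {K X Y : C} {k : K ⟶ X} {f : X ⟶ Y} {s : Y ⟶ X}
    (h : IsSplitExtension k f s) : IsSplitExtension (discHom k : disc K ⟶ disc X)
      (discHom f : disc X ⟶ disc Y) (discHom s : disc Y ⟶ disc X) := by
  have := h.mono
  have hz (T : C) : Mono (0 : (0 : C) ⟶ T) := ⟨fun _ _ _ => (isZero_zero C).eq_of_tgt _ _⟩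
  have : Mono (disc K).bd := hz K
  have : Mono (discHom k : disc K ⟶ disc X).fA := h.mono
  have : Mono (discHom k : disc K ⟶ disc X).fX := hz 0
  have := mono_of_components (discHom k : disc K ⟶ disc X)
  refine .of_lift (disc_hom_ext h.section_comp) (disc_hom_ext h.comp_zero) fun {T} t ht => ?_
  obtain ⟨l, hl⟩ := h.exists_lift t.fA (congrArg Hom.fA ht)
  have hl' : T.bd ≫ l = 0 := by
    rw [← cancel_mono k, Category.assoc, hl, zero_comp]
    exact t.bd_comm.trans comp_zero
  exact ⟨homOfMono 0 l (hl'.trans zero_comp.symm), hom_ext ((isZero_zero C).eq_of_tgt _ _) hl⟩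

end XMod

open XMod

theorem conditionP_of_conditionP_xmod (h : ConditionP (XMod C)) : ConditionP C :=
  fun _ _ _ _ _ _ hs hX => isRegProjective_disc_iff.1
    (h _ _ _ (isSplitExtension_disc hs) (isRegProjective_disc_iff.2 hX))

theorem conditionP_xmod (hC : EnoughRegProjectives C) (h : ConditionP C) :
    ConditionP (XMod C) := by
  intro K M N k f s hs hM
  have hA := isSplitExtension_fA hs
  have hX := isSplitExtension_fX hs
  obtain ⟨QM, qM, sM, hqM, hMA, hQM⟩ := IsRegProjective.exists_isSplitExtension hC hM
  obtain ⟨QN, qN, sN, hqN, -, -⟩ := IsRegProjective.exists_isSplitExtension hC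
    (hM.of_retract s f hs.section_comp)
  have := hA.mono
  have := hX.mono
  have := hqM.mono
  have := hqN.mono
  have hKA : IsRegProjective K.A := h _ _ _ hA hMA
  have hKX : IsRegProjective K.X := h _ _ _ hX (h _ _ _ hqM hMA)
  -- `sM ≫ f.fA ≫ qN` and `sN ≫ s.fA ≫ qM` are the morphisms that `f` and `s` induce between the
  -- quotients `QM` and `QN`, independently of the chosen sections.
  have hf : qM ≫ sM ≫ f.fA ≫ qN = f.fA ≫ qN := by
    refine hqM.hom_ext ?_ ?_
    · rw [reassoc_of% hqM.comp_zero, zero_comp, reassoc_of% f.bd_comm, hqN.comp_zero, comp_zero]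
    · rw [reassoc_of% hqM.section_comp]
  have hs' : qN ≫ sN ≫ s.fA ≫ qM = s.fA ≫ qM := by
    refine hqN.hom_ext ?_ ?_
    · rw [reassoc_of% hqN.comp_zero, zero_comp, reassoc_of% s.bd_comm, hqM.comp_zero, comp_zero]
    · rw [reassoc_of% hqN.section_comp]
  have hQ : IsSplitExtension (kernel.ι (sM ≫ f.fA ≫ qN)) (sM ≫ f.fA ≫ qN)
      (sN ≫ s.fA ≫ qM) := .kernel_ι (by
    rw [Category.assoc, Category.assoc, hf, reassoc_of% hA.section_comp, hqN.section_comp])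
  let q : K.A ⟶ kernel (sM ≫ f.fA ≫ qN) := kernel.lift _ (k.fA ≫ qM) (by
    rw [Category.assoc, hf, reassoc_of% hA.comp_zero, zero_comp])
  have hq : q ≫ kernel.ι _ = k.fA ≫ qM := kernel.lift_ι _ _ _
  have : IsSplitEpi qM := ⟨⟨⟨sM, hqM.section_comp⟩⟩⟩
  have : StrongEpi q := strongEpi_kernel hA hQ q qM qN hq.symm hf.symm hs'.symm
  have hKQ : IsRegProjective (kernel (sM ≫ f.fA ≫ qN)) := h _ _ _ hQ hQM
  obtain ⟨σ, hσ⟩ := hKQ.exists_lift q (𝟙 _)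
  have : Mono K.bd := by
    have : Mono (K.bd ≫ k.fA) := by rw [k.bd_comm]; infer_instance
    exact mono_of_mono K.bd k.fA
  refine isRegProjective_of_isSplitExtension (q := q) (s := σ) (.of_lift hσ ?_ fun t ht => ?_)
    hKX hKA hKQ
  · rw [← cancel_mono (kernel.ι _), Category.assoc, hq, reassoc_of% k.bd_comm, hqM.comp_zero,
      comp_zero, zero_comp]
  -- `K.bd` is the kernel of `q`: what `q` kills comes from `M.X`, and then from `K.X` because
  -- `N.bd` is monic.
  · obtain ⟨a, ha⟩ := hqM.exists_lift (t ≫ k.fA) (by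
      rw [Category.assoc, ← hq, reassoc_of% ht, zero_comp])
    obtain ⟨b, hb⟩ := hX.exists_lift a (by
      rw [← cancel_mono N.bd, Category.assoc, ← f.bd_comm, reassoc_of% ha, hA.comp_zero,
        comp_zero, zero_comp])
    exact ⟨b, by rw [← cancel_mono k.fA, Category.assoc, k.bd_comm, reassoc_of% hb, ha]⟩

end Projectives

end SemiAb

/-! ### Free algebras and enough projectives in a variety. -/

namespace SemiAb

namespace Alg

open FirstOrder FirstOrder.Language

variable {L : FirstOrder.Language.{u, w}} {E : Set (L.Term ℕ × L.Term ℕ)}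

/-- The underlying function of a homomorphism of algebras. -/
def fn {A B : Alg L E} (f : A ⟶ B) : A.carrier → B.carrier :=
  FirstOrder.Language.Hom.toFun f

lemma fn_comp {A B D : Alg L E} (f : A ⟶ B) (g : B ⟶ D) (x : A.carrier) :
    fn (f ≫ g) x = fn g (fn f x) := rfl

lemma hom_ext {A B : Alg L E} {f g : A ⟶ B} (h : ∀ x, fn f x = fn g x) : f = g :=
  FirstOrder.Language.Hom.ext h

/-- A subalgebra of an algebra of a variety. -/
def ofSubstructure (A : Alg L E) (S : L.Substructure A.carrier) : Alg L E where
  carrier := S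
  sat e he x := S.subtype.injective (by
    rw [← HomClass.realize_term, ← HomClass.realize_term]
    exact A.sat e he _)

/-- The corestriction of `e` to its range descends along `e` to a section of the inclusion of the
range. -/
lemma surjective_of_isRegularEpi [L.IsAlgebraic] {A B : Alg L E} (e : A ⟶ B) [IsRegularEpi e] :
    Function.Surjective (fn e) := by
  let e' : L.Hom A.carrier B.carrier := e
  let I : Alg L E := B.ofSubstructure e'.range
  let g : A ⟶ I := e'.codRestrict e'.range fun x => ⟨x, rfl⟩
  let i : I ⟶ B := e'.range.subtype.toHom
  have hgi : g ≫ i = e := hom_ext fun _ => rfl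
  have hi : Function.Injective (fn i) := Subtype.val_injective
  have hg : IsRegularEpi.left e ≫ g = IsRegularEpi.right e ≫ g := hom_ext fun x => hi (by
    rw [← fn_comp, ← fn_comp, Category.assoc, Category.assoc, hgi, IsRegularEpi.w e])
  have hd : IsRegularEpi.desc e g hg ≫ i = 𝟙 B := by
    have := RegularEpi.epi e (IsRegularEpi.getStruct e)
    rw [← cancel_epi e, ← Category.assoc, IsRegularEpi.fac, hgi, Category.comp_id]
  intro y
  obtain ⟨x, hx⟩ := (show I.carrier from fn (IsRegularEpi.desc e g hg) y).2
  exact ⟨x, hx.trans (congrArg (fun f => fn f y) hd)⟩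

section Free

variable (L E) in
/-- Two terms are identified in the free algebra if they agree in every algebra. -/
def termSetoid (α : Type u) : Setoid (L.Term α) where
  -- Semantic equality replaces derivability from `E`. Function symbols and `α` live in `Type u`,
  -- hence so do terms, and the quotient is again an object of `Alg L E`.
  r t t' := ∀ (B : Alg L E) (v : α → B.carrier), t.realize v = t'.realize v
  iseqv := ⟨fun _ _ _ => rfl, fun h B v => (h B v).symm, fun h h' B v => (h B v).trans (h' B v)⟩

variable (L E) in
/-- The underlying set of the free algebra. -/
def FreeCarrier (α : Type u) : Type u := Quotient (termSetoid L E α)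

noncomputable instance (α : Type u) : L.Structure (FreeCarrier L E α) where
  funMap f x := Quotient.mk _ (Term.func f fun i => (x i).out)
  RelMap _ _ := False

/-- The class of a term in the free algebra. -/
def freeMk {α : Type u} (t : L.Term α) : FreeCarrier L E α := Quotient.mk _ t

/-- A term representing an element of the free algebra. -/
noncomputable def freeOut {α : Type u} (x : FreeCarrier L E α) : L.Term α := Quotient.out x

lemma freeMk_freeOut {α : Type u} (x : FreeCarrier L E α) : freeMk (freeOut x) = x :=
  Quotient.out_eq x

lemma funMap_freeMk {α : Type u} {n : ℕ} (f : L.Functions n) (t : Fin n → L.Term α) :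
    Structure.funMap f (fun i => (freeMk (t i) : FreeCarrier L E α)) =
      freeMk (Term.func f t) := by
  refine Quotient.sound fun B v => ?_
  simp only [Term.realize_func]
  congr 1
  funext i
  exact Quotient.exact (Quotient.out_eq (freeMk (t i) : FreeCarrier L E α)) B v

lemma realize_freeMk {α : Type u} {β : Type*} (t : L.Term β) (s : β → L.Term α) :
    t.realize (fun i => (freeMk (s i) : FreeCarrier L E α)) = freeMk (t.subst s) := by
  induction t with
  | var i => rfl
  | func f ts ih =>
    simp only [Term.realize_func, ih, Term.subst]
    exact funMap_freeMk f _

variable (L E) in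
/-- The free algebra on a set. -/
noncomputable def free (α : Type u) : Alg L E where
  carrier := FreeCarrier L E α
  sat e he x := by
    have hx : x = fun i => freeMk (freeOut (x i)) := funext fun i => (freeMk_freeOut (x i)).symm
    rw [hx, realize_freeMk, realize_freeMk]
    refine Quotient.sound fun B v => ?_
    rw [Term.realize_subst, Term.realize_subst]
    exact B.sat e he _

/-- The generators of the free algebra. -/
def freeOf {α : Type u} (a : α) : (free L E α).carrier :=
  (freeMk (Term.var a) : FreeCarrier L E α)

lemma free_hom_ext {α : Type u} {B : Alg L E} {f g : free L E α ⟶ B}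
    (h : ∀ a, fn f (freeOf a) = fn g (freeOf a)) : f = g := by
  refine hom_ext fun x => ?_
  obtain ⟨t, rfl⟩ : ∃ t : L.Term α, (freeMk t : FreeCarrier L E α) = x := ⟨_, freeMk_freeOut x⟩
  induction t with
  | var a => exact h a
  | func F ts ih =>
    have h₁ := FirstOrder.Language.Hom.map_fun (L := L) (M := FreeCarrier L E α) f F
      fun i => freeMk (ts i)
    have h₂ := FirstOrder.Language.Hom.map_fun (L := L) (M := FreeCarrier L E α) g F
      fun i => freeMk (ts i)
    have h₃ := funMap_freeMk (E := E) F ts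
    exact (congrArg (fn f) h₃).symm.trans
      (h₁.trans ((congrArg _ (funext ih)).trans (h₂.symm.trans (congrArg (fn g) h₃))))

variable [L.IsAlgebraic]

/-- The homomorphism out of a free algebra extending a given function. -/
noncomputable def freeLift {α : Type u} {B : Alg L E} (v : α → B.carrier) : free L E α ⟶ B :=
  { toFun := Quotient.lift (fun t : L.Term α => t.realize v) fun _ _ h => h B v
    map_fun' := fun {n} f x => by
      have hx : x = fun i => freeMk (freeOut (x i)) := funext fun i => (freeMk_freeOut (x i)).symm
      rw [hx]
      erw [funMap_freeMk]
      rfl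
    map_rel' := fun r => isEmptyElim r : L.Hom (FreeCarrier L E α) B.carrier }

lemma isRegProjective_free (α : Type u) : IsRegProjective (free L E α) := by
  intro X Y e f he
  choose v hv using fun a => surjective_of_isRegularEpi e (fn f (freeOf a))
  exact ⟨freeLift v, free_hom_ext hv⟩

lemma injective_of_mono {A B : Alg L E} (f : A ⟶ B) [Mono f] : Function.Injective (fn f) := by
  intro x y hxy
  have : (freeLift (fun _ : PUnit.{u + 1} => x) : free L E PUnit ⟶ A) = freeLift fun _ => y := by
    rw [← cancel_mono f]
    exact free_hom_ext fun _ => hxy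
  exact congrArg (fun g => fn g (freeOf PUnit.unit)) this

end Free

lemma isIso_of_bijective [L.IsAlgebraic] {A B : Alg L E} (f : A ⟶ B)
    (hf : Function.Bijective (fn f)) : IsIso f := by
  let e := Equiv.ofBijective _ hf
  let g : B ⟶ A := (
    { toFun := e.symm
      map_fun' := fun F x => by
        apply hf.1
        refine (e.apply_symm_apply _).trans ?_
        refine Eq.trans ?_ (FirstOrder.Language.Hom.map_fun (L := L) f F _).symm
        exact congrArg _ (funext fun i => (e.apply_symm_apply (x i)).symm)
      map_rel' := fun r => isEmptyElim r } : L.Hom B.carrier A.carrier)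
  exact ⟨g, hom_ext e.symm_apply_apply, hom_ext e.apply_symm_apply⟩

/-- The free algebra on the underlying set of `X` surjects onto `X`; a monomorphism through which
this surjection factors is bijective, hence invertible. -/
lemma enoughRegProjectives [L.IsAlgebraic] [HasZeroMorphisms (Alg L E)]
    [IsSemiAbelian (Alg L E)] : EnoughRegProjectives (Alg L E) := by
  intro X
  let e : free L E X.carrier ⟶ X := freeLift id
  have : StrongEpi e := strongEpi_of_forall_mono e fun Z p i _ hp =>
    isIso_of_bijective i ⟨injective_of_mono i, fun x => ⟨fn p (freeOf x), by
      rw [← fn_comp, hp]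
      rfl⟩⟩
  exact ⟨free L E X.carrier, e, isRegProjective_free _, isRegularEpi_of_strongEpi e⟩

end Alg

end SemiAb

theorem mainTheorem4 (L : FirstOrder.Language.{u, w}) [L.IsAlgebraic]
    (E : Set (L.Term ℕ × L.Term ℕ)) [HasZeroMorphisms (SemiAb.Alg L E)]
    [SemiAb.IsSemiAbelian (SemiAb.Alg L E)] :
    SemiAb.ConditionP (SemiAb.Alg L E) ↔ SemiAb.ConditionP (SemiAb.XMod (SemiAb.Alg L E)) :=
  ⟨SemiAb.conditionP_xmod SemiAb.Alg.enoughRegProjectives, SemiAb.conditionP_of_conditionP_xmod⟩
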